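/- For an integer $n>0$ let $E_n\colon y^2=x^3-n^2x$ and $E_{1,n}\colon y^2=x^3+4n^2x$ over $\mathbb{Q}$, let $\varphi_1\colon E_n\to E_{1,n}$ be the $2$-isogeny $(x,y)\mapsto\left(\frac{y^2}{x^2},-\frac{y(n^2+x^2)}{x^2}\right)$ with kernel $\{\infty,(0,0)\}$, and let $\widehat{\varphi_1}\colon E_{1,n}\to E_n$, $(x,y)\mapsto\left(\frac{y^2}{4x^2},\frac{y(4n^2-x^2)}{8x^2}\right)$, be its dual isogeny. Let $T$ and $T_1$ be the torsion subgroups of $E_n(\mathbb{Q})$ and $E_{1,n}(\mathbb{Q})$. Proposition 6.3. Let $n>1$ be an integer that is not a perfect square (for instance, a squarefree integer $n>1$). There exist subgroups $A\subseteq E_n(\mathbb{Q})$ and $A_1\subseteq E_{1,n}(\mathbb{Q})$ such that $E_n(\mathbb{Q})=T\oplus A$, $E_{1,n}(\mathbb{Q})=T_1\oplus A_1$ and $\widehat{\varphi_1}(A_1)\subseteq A$. For every such choice, $A$ and $A_1$ are free abelian groups of the same finite rank $r$, the $\mathbb{F}_2$-vector spaces below are finite-dimensional, and $$\dim_{\mathbb{F}_2}A/\widehat{\varphi_1}(A_1)=\dim_{\mathbb{F}_2}\frac{E_n(\mathbb{Q})}{\widehat{\varphi_1}(E_{1,n}(\mathbb{Q}))}-2,\qquad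 r=\dim_{\mathbb{F}_2}A/2A=\dim_{\mathbb{F}_2}\frac{E_n(\mathbb{Q})}{2E_n(\mathbb{Q})}-2.$$ Moreover, the torsion contributes exactly the four $2$-torsion points: $E_n(\mathbb{Q})[2]=\{\infty,(0,0),(n,0),(-n,0)\}$ has four elements, and the natural maps $E_n(\mathbb{Q})[2]\to T/2T$ and $E_n(\mathbb{Q})[2]\to T/\widehat{\varphi_1}(T_1)$ are bijective. -/

import Mathlib

open WeierstrassCurve

/-- The curve `E_n : y² = x³ - n² x` over `ℚ`. -/
def curveE (n : ℕ) : WeierstrassCurve.Affine ℚ where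
  a₁ := 0
  a₂ := 0
  a₃ := 0
  a₄ := -(n : ℚ) ^ 2
  a₆ := 0

/-- The curve `E_{1,n} : y² = x³ + 4 n² x` over `ℚ`. -/
def curveE₁ (n : ℕ) : WeierstrassCurve.Affine ℚ where
  a₁ := 0
  a₂ := 0
  a₃ := 0
  a₄ := 4 * (n : ℚ) ^ 2
  a₆ := 0

theorem curveE_nonsingular_iff {n : ℕ} {x y : ℚ} : (curveE n).Nonsingular x y ↔
    y ^ 2 = x ^ 3 - n ^ 2 * x ∧ (3 * x ^ 2 ≠ n ^ 2 ∨ y ≠ 0) := by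
  rw [Affine.nonsingular_iff', Affine.equation_iff]
  simp only [curveE]
  constructor
  · rintro ⟨h, h'⟩
    refine ⟨by linarith, ?_⟩
    rcases h' with h' | h'
    · left; intro h2; apply h'; linarith
    · right; intro h2; apply h'; simp [h2]
  · rintro ⟨h, h'⟩
    refine ⟨by linarith, ?_⟩
    rcases h' with h' | h'
    · left; intro h2; apply h'; linarith
    · right; intro h2; apply h'; linarith

theorem curveE₁_nonsingular_iff {n : ℕ} {x y : ℚ} : (curveE₁ n).Nonsingular x y ↔
    y ^ 2 = x ^ 3 + 4 * n ^ 2 * x ∧ (3 * x ^ 2 + 4 * n ^ 2 ≠ 0 ∨ y ≠ 0) := by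
  rw [Affine.nonsingular_iff', Affine.equation_iff]
  simp only [curveE₁]
  constructor
  · rintro ⟨h, h'⟩
    refine ⟨by linarith, ?_⟩
    rcases h' with h' | h'
    · left; intro h2; apply h'; linarith
    · right; intro h2; apply h'; simp [h2]
  · rintro ⟨h, h'⟩
    refine ⟨by linarith, ?_⟩
    rcases h' with h' | h'
    · left; intro h2; apply h'; linarith
    · right; intro h2; apply h'; linarith

theorem phi_nonsingular {n : ℕ} {x y : ℚ} (h : (curveE n).Nonsingular x y) (hx : x ≠ 0) :
    (curveE₁ n).Nonsingular (y ^ 2 / x ^ 2) (-(y * (n ^ 2 + x ^ 2)) / x ^ 2) := by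
  obtain ⟨h1, h2⟩ := curveE_nonsingular_iff.1 h
  rw [curveE₁_nonsingular_iff]
  constructor
  · field_simp
    grind
  · by_cases hy : y = 0
    · left
      have hn : (n : ℚ) ^ 2 = x ^ 2 := by
        have : x * (x ^ 2 - n ^ 2) = 0 := by rw [hy] at h1; linarith
        rcases mul_eq_zero.1 this with h | h
        · exact absurd h hx
        · linarith
      rw [hn]
      positivity
    · right
      have : (n : ℚ) ^ 2 + x ^ 2 ≠ 0 := by positivity
      exact div_ne_zero (neg_ne_zero.2 (mul_ne_zero hy this)) (by positivity)

theorem phiHat_nonsingular {n : ℕ} {x y : ℚ} (h : (curveE₁ n).Nonsingular x y) (hx : x ≠ 0) :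
    (curveE n).Nonsingular (y ^ 2 / (4 * x ^ 2)) (y * (4 * n ^ 2 - x ^ 2) / (8 * x ^ 2)) := by
  obtain ⟨h1, h2⟩ := curveE₁_nonsingular_iff.1 h
  rw [curveE_nonsingular_iff]
  have hpos : 0 < x ^ 2 + 4 * (n : ℚ) ^ 2 := by positivity
  have hy : y ≠ 0 := by
    rintro rfl
    have : x * (x ^ 2 + 4 * n ^ 2) = 0 := by linarith
    rcases mul_eq_zero.1 this with h | h
    · exact hx h
    · exact hpos.ne' h
  constructor
  · field_simp
    grind
  · by_cases hxn : 4 * (n : ℚ) ^ 2 - x ^ 2 = 0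
    · left
      have hn : (n : ℚ) ^ 2 = x ^ 2 / 4 := by linarith
      have : y ^ 2 / (4 * x ^ 2) = x / 2 := by
        rw [h1]; field_simp; linarith
      rw [this, hn]
      intro h
      apply hx
      nlinarith
    · right
      exact div_ne_zero (mul_ne_zero hy hxn) (by positivity)

/-- The `2`-isogeny `φ₁ : E_n → E_{1,n}`, `(x, y) ↦ (y²/x², -y(n² + x²)/x²)`, on rational
points; its kernel is `{∞, (0,0)}`. -/
noncomputable def phiFun (n : ℕ) : (curveE n).Point → (curveE₁ n).Point
  | .zero => 0
  | .some x y h => if hx : x = 0 then 0 else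
      .some (y ^ 2 / x ^ 2) (-(y * (n ^ 2 + x ^ 2)) / x ^ 2) (phi_nonsingular h hx)

/-- The dual isogeny `φ̂₁ : E_{1,n} → E_n`, `(x, y) ↦ (y²/(4x²), y(4n² - x²)/(8x²))`, on rational
points; its kernel is `{∞, (0,0)}`. It is dual to `φ₁`: both composites are multiplication by `2`
(`phiHatFun_phiFun`, `phiFun_phiHatFun`), and it is additive (`phiHatFun_add`). -/
noncomputable def phiHatFun (n : ℕ) : (curveE₁ n).Point → (curveE n).Point
  | .zero => 0
  | .some x y h => if hx : x = 0 then 0 else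
      .some (y ^ 2 / (4 * x ^ 2)) (y * (4 * n ^ 2 - x ^ 2) / (8 * x ^ 2)) (phiHat_nonsingular h hx)

theorem phiHatFun_zero (n : ℕ) : phiHatFun n 0 = 0 := rfl

theorem phiHatFun_some {n : ℕ} {x y : ℚ} (h : (curveE₁ n).Nonsingular x y) (hx : x ≠ 0) :
    phiHatFun n (.some x y h) = .some (y ^ 2 / (4 * x ^ 2)) (y * (4 * n ^ 2 - x ^ 2) / (8 * x ^ 2))
      (phiHat_nonsingular h hx) := dif_neg hx

theorem phiHatFun_some_zero {n : ℕ} {y : ℚ} (h : (curveE₁ n).Nonsingular 0 y) :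
    phiHatFun n (.some 0 y h) = 0 := by
  simp [phiHatFun]

theorem phiHatFun_neg (n : ℕ) (P : (curveE₁ n).Point) : phiHatFun n (-P) = -phiHatFun n P := by
  match P with
  | .zero => rfl
  | .some x y h =>
    rw [Affine.Point.neg_some]
    by_cases hx : x = 0
    · subst hx
      rw [phiHatFun_some_zero, phiHatFun_some_zero, neg_zero]
    · rw [phiHatFun_some _ hx, phiHatFun_some _ hx, Affine.Point.neg_some, Affine.Point.some.injEq]
      simp only [Affine.negY, curveE, curveE₁]
      constructor <;> ring

/-- Translation by `(0,0)` does not change the image under `φ̂₁`. -/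
theorem phiHatFun_add_two_torsion {n : ℕ} {x y y₀ : ℚ} (h₀ : (curveE₁ n).Nonsingular 0 y₀)
    (h : (curveE₁ n).Nonsingular x y) (hx : x ≠ 0) :
    phiHatFun n (.some 0 y₀ h₀ + .some x y h) = phiHatFun n (.some x y h) := by
  obtain ⟨h1, h2⟩ := curveE₁_nonsingular_iff.1 h
  obtain ⟨h3, h4⟩ := curveE₁_nonsingular_iff.1 h₀
  have hy₀ : y₀ = 0 := by
    have : y₀ ^ 2 = 0 := by rw [h3]; ring
    exact pow_eq_zero_iff (two_ne_zero) |>.1 this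
  subst hy₀
  have hn : (n : ℚ) ≠ 0 := by
    rcases h4 with h | h
    · intro h'; simp [h'] at h
    · simp at h
  have hsl : (curveE₁ n).slope 0 x 0 y = y / x := by
    rw [Affine.slope_of_X_ne hx.symm]; field_simp; ring
  have hX : (curveE₁ n).addX 0 x ((curveE₁ n).slope 0 x 0 y) = 4 * n ^ 2 / x := by
    rw [hsl]; simp only [Affine.addX, curveE₁]; field_simp; grind
  have hY : (curveE₁ n).addY 0 x 0 ((curveE₁ n).slope 0 x 0 y) = - 4 * n ^ 2 * y / x ^ 2 := by
    rw [Affine.addY, Affine.negAddY, hX, hsl]; simp only [Affine.negY, curveE₁]; field_simp; ring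
  have hX0 : 4 * (n : ℚ) ^ 2 / x ≠ 0 := by positivity
  rw [Affine.Point.add_of_X_ne hx.symm, phiHatFun_some _ hx, phiHatFun_some _ (by rw [hX]; exact hX0),
    Affine.Point.some.injEq]
  rw [hX, hY]
  constructor
  · field_simp
  · field_simp; ring

theorem phiHatFun_phiFun (n : ℕ) (P : (curveE n).Point) : phiHatFun n (phiFun n P) = 2 • P := by
  match P with
  | .zero => exact (smul_zero (A := (curveE n).Point) 2).symm
  | .some x y h =>
    obtain ⟨h1, h2⟩ := curveE_nonsingular_iff.1 h
    rw [two_smul]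
    by_cases hy : y = 0
    · subst hy
      rw [Affine.Point.add_self_of_Y_eq (by simp [Affine.negY, curveE])]
      by_cases hx : x = 0
      · subst hx
        simp [phiFun, phiHatFun_zero]
      · simp [phiFun, hx, phiHatFun]
    · have hx : x ≠ 0 := by
        rintro rfl
        apply hy
        have : y ^ 2 = 0 := by rw [h1]; ring
        exact pow_eq_zero_iff (two_ne_zero) |>.1 this
      have hyn : y ≠ (curveE n).negY x y := by
        simp only [Affine.negY, curveE]
        intro h
        apply hy
        linarith
      have hsl : (curveE n).slope x x y y = (3 * x ^ 2 - n ^ 2) / (2 * y) := by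
        rw [Affine.slope_of_Y_ne rfl hyn]
        simp only [Affine.negY, curveE]
        congr 1 <;> ring
      rw [phiFun, dif_neg hx, phiHatFun_some _ (by positivity), Affine.Point.add_self_of_Y_ne hyn,
        Affine.Point.some.injEq, Affine.addY, Affine.negAddY, hsl]
      simp only [Affine.negY, Affine.addX, curveE]
      constructor
      · field_simp
        grind
      · field_simp
        grind

theorem alg_aux {a s p q : ℚ} (ha : a ≠ 0) (hp : p ≠ 0) (hq : q ≠ 0)
    (hr : s * (2 * (2 * a - p * q)) = a * (p ^ 2 + q ^ 2)) {L l v x₃ : ℚ}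
    (hL : L = (p * (3 * q ^ 2 + p ^ 2) / 4 - s * p - a * q) / (2 * p * q))
    (hl : l = (s * p / a + q) / 2) (hv : v = l - a / p) (hx₃ : x₃ = l ^ 2 - s) :
    v ^ 2 / 4 = L ^ 2 - (p ^ 2 + q ^ 2) / 8 ∧
    v * (v ^ 2 - 2 * x₃) / 8 = L * (v ^ 2 / 4 - ((q + p) / 2) ^ 2 / 4) +
      ((q + p) / 2) * (((q + p) / 2) ^ 2 - (s + a)) / 8 := by
  have hd : 2 * a - p * q ≠ 0 := by
    intro hd
    rw [hd] at hr
    have : p ^ 2 + q ^ 2 = 0 := by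
      have : a * (p ^ 2 + q ^ 2) = 0 := by linarith
      simpa [ha] using this
    have : 0 < p ^ 2 + q ^ 2 := by positivity
    linarith
  have hs : s = a * (p ^ 2 + q ^ 2) / (2 * (2 * a - p * q)) := by
    rw [eq_div_iff (by simpa using hd)]; exact hr
  obtain ⟨d, hd'⟩ : ∃ d, d = 2 * a - p * q := ⟨_, rfl⟩
  obtain rfl : a = (d + p * q) / 2 := by linarith
  rw [← hd'] at hd hs
  have ha' : d + p * q ≠ 0 := fun h => ha (by rw [h]; simp)
  clear hr hd' ha
  subst hx₃ hv hl hL hs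
  constructor
  · field_simp
    ring
  · field_simp
    ring

theorem alg {x₁ x₂ w₁ w₂ : ℚ} (hx : x₁ - x₂ ≠ 0) (hw : w₁ - w₂ ≠ 0) (hw' : w₁ + w₂ ≠ 0)
    (hr : x₁ * w₁ ^ 2 - x₁ ^ 2 = x₂ * w₂ ^ 2 - x₂ ^ 2) {L l v x₃ : ℚ}
    (hL : L = (w₁ ^ 3 - w₂ ^ 3 - 2 * (x₁ * w₁ - x₂ * w₂)) / (2 * (w₁ - w₂) * (w₁ + w₂)))
    (hl : l = (x₁ * w₁ - x₂ * w₂) / (x₁ - x₂)) (hv : v = l - (x₁ - x₂) / (w₁ - w₂))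
    (hx₃ : x₃ = l ^ 2 - x₁ - x₂) :
    v ^ 2 / 4 = L ^ 2 - w₁ ^ 2 / 4 - w₂ ^ 2 / 4 ∧
    v * (v ^ 2 - 2 * x₃) / 8 = L * (v ^ 2 / 4 - w₁ ^ 2 / 4) + w₁ * (w₁ ^ 2 - 2 * x₁) / 8 := by
  have := alg_aux (a := x₁ - x₂) (s := x₁ + x₂) (p := w₁ - w₂) (q := w₁ + w₂) hx hw hw'
    (by linear_combination -4 * hr) (L := L) (l := l) (v := v) (x₃ := x₃)
    (by rw [hL]; congr 1; ring) (by rw [hl]; field_simp; ring) hv (by rw [hx₃]; ring)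
  obtain ⟨h1, h2⟩ := this
  constructor
  · rw [h1]; ring
  · rw [h2]; ring

theorem phiFun_phiHatFun (n : ℕ) (P : (curveE₁ n).Point) : phiFun n (phiHatFun n P) = 2 • P := by
  match P with
  | .zero => exact (smul_zero (A := (curveE₁ n).Point) 2).symm
  | .some x y h =>
    obtain ⟨h1, h2⟩ := curveE₁_nonsingular_iff.1 h
    rw [two_smul]
    by_cases hx : x = 0
    · subst hx
      have hy : y = 0 := by
        have : y ^ 2 = 0 := by rw [h1]; ring
        exact pow_eq_zero_iff (two_ne_zero) |>.1 this
      subst hy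
      rw [Affine.Point.add_self_of_Y_eq (by simp [Affine.negY, curveE₁]), phiHatFun_some_zero]
      rfl
    · have hy : y ≠ 0 := by
        rintro rfl
        have hpos : 0 < x ^ 2 + 4 * (n : ℚ) ^ 2 := by positivity
        have : x * (x ^ 2 + 4 * n ^ 2) = 0 := by linarith
        rcases mul_eq_zero.1 this with h | h
        · exact hx h
        · exact hpos.ne' h
      have hyn : y ≠ (curveE₁ n).negY x y := by
        simp only [Affine.negY, curveE₁]
        intro h
        apply hy
        linarith
      have hsl : (curveE₁ n).slope x x y y = (3 * x ^ 2 + 4 * n ^ 2) / (2 * y) := by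
        rw [Affine.slope_of_Y_ne rfl hyn]
        simp only [Affine.negY, curveE₁]
        congr 1 <;> ring
      rw [phiHatFun_some _ hx, phiFun, dif_neg (by positivity), Affine.Point.add_self_of_Y_ne hyn,
        Affine.Point.some.injEq, Affine.addY, Affine.negAddY, hsl]
      simp only [Affine.negY, Affine.addX, curveE₁]
      constructor
      · field_simp
        grind
      · field_simp
        grind

theorem phiHatFun_two_smul (n : ℕ) (P : (curveE₁ n).Point) :
    phiHatFun n (2 • P) = 2 • phiHatFun n P := by
  rw [← phiFun_phiHatFun, phiHatFun_phiFun]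

theorem phiHatFun_add_two_torsion' {n : ℕ} {y₀ : ℚ} (h₀ : (curveE₁ n).Nonsingular 0 y₀)
    (P : (curveE₁ n).Point) : phiHatFun n (.some 0 y₀ h₀ + P) = phiHatFun n P := by
  match P with
  | .zero => exact (congrArg _ (add_zero _)).trans (phiHatFun_some_zero h₀)
  | .some x y h =>
    by_cases hx : x = 0
    · subst hx
      have hy : ∀ {z : ℚ}, (curveE₁ n).Nonsingular 0 z → z = 0 := by
        intro z hz
        have : z ^ 2 = 0 := by rw [(curveE₁_nonsingular_iff.1 hz).1]; ring
        exact pow_eq_zero_iff (two_ne_zero) |>.1 this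
      obtain rfl := hy h
      obtain rfl := hy h₀
      rw [Affine.Point.add_self_of_Y_eq (by simp [Affine.negY, curveE₁]), phiHatFun_some_zero,
        phiHatFun_zero]
    · exact phiHatFun_add_two_torsion h₀ h hx

theorem phiHatFun_add_generic {n : ℕ} {x₁ y₁ x₂ y₂ : ℚ} (h₁ : (curveE₁ n).Nonsingular x₁ y₁)
    (h₂ : (curveE₁ n).Nonsingular x₂ y₂) (hx₁ : x₁ ≠ 0) (hx₂ : x₂ ≠ 0) (hx : x₁ ≠ x₂)
    (hxx : x₁ * x₂ ≠ 4 * (n : ℚ) ^ 2) :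
    phiHatFun n (.some x₁ y₁ h₁ + .some x₂ y₂ h₂) =
      phiHatFun n (.some x₁ y₁ h₁) + phiHatFun n (.some x₂ y₂ h₂) := by
  obtain ⟨e₁, -⟩ := curveE₁_nonsingular_iff.1 h₁
  obtain ⟨e₂, -⟩ := curveE₁_nonsingular_iff.1 h₂
  obtain ⟨w₁, rfl⟩ : ∃ w, y₁ = x₁ * w := ⟨y₁ / x₁, by field_simp⟩
  obtain ⟨w₂, rfl⟩ : ∃ w, y₂ = x₂ * w := ⟨y₂ / x₂, by field_simp⟩
  have f₁ : 4 * (n : ℚ) ^ 2 = x₁ * w₁ ^ 2 - x₁ ^ 2 := by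
    apply mul_left_cancel₀ hx₁; linear_combination - e₁
  have f₂ : 4 * (n : ℚ) ^ 2 = x₂ * w₂ ^ 2 - x₂ ^ 2 := by
    apply mul_left_cancel₀ hx₂; linear_combination - e₂
  have hr := f₁.symm.trans f₂
  have hsub : x₁ - x₂ ≠ 0 := sub_ne_zero.2 hx
  have hww : (w₁ - w₂) * (w₁ + w₂) ≠ 0 := by
    intro h
    have : (x₁ - x₂) * (x₁ * x₂ - 4 * n ^ 2) = 0 := by
      have hw : w₁ ^ 2 = w₂ ^ 2 := by linear_combination h
      rw [hw] at f₁
      linear_combination x₂ * f₁ - x₁ * f₂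
    rcases mul_eq_zero.1 this with h | h
    · exact hsub h
    · exact hxx (sub_eq_zero.1 h)
  have hw := left_ne_zero_of_mul hww
  have hw' := right_ne_zero_of_mul hww
  have hsl : (curveE₁ n).slope x₁ x₂ (x₁ * w₁) (x₂ * w₂) = (x₁ * w₁ - x₂ * w₂) / (x₁ - x₂) :=
    Affine.slope_of_X_ne hx
  have X1 : (x₁ * w₁) ^ 2 / (4 * x₁ ^ 2) = w₁ ^ 2 / 4 := by field_simp
  have X2 : (x₂ * w₂) ^ 2 / (4 * x₂ ^ 2) = w₂ ^ 2 / 4 := by field_simp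
  have Y1 : (x₁ * w₁) * (4 * n ^ 2 - x₁ ^ 2) / (8 * x₁ ^ 2) = w₁ * (w₁ ^ 2 - 2 * x₁) / 8 := by
    rw [f₁]; field_simp; ring
  have Y2 : (x₂ * w₂) * (4 * n ^ 2 - x₂ ^ 2) / (8 * x₂ ^ 2) = w₂ * (w₂ ^ 2 - 2 * x₂) / 8 := by
    rw [f₂]; field_simp; ring
  have hX : (x₁ * w₁) ^ 2 / (4 * x₁ ^ 2) ≠ (x₂ * w₂) ^ 2 / (4 * x₂ ^ 2) := by
    rw [X1, X2]; intro h; apply hww; linear_combination 4 * h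
  obtain ⟨l, hl⟩ : ∃ l, l = (x₁ * w₁ - x₂ * w₂) / (x₁ - x₂) := ⟨_, rfl⟩
  obtain ⟨v, hv⟩ : ∃ v, v = l - (x₁ - x₂) / (w₁ - w₂) := ⟨_, rfl⟩
  obtain ⟨x₃, hx₃⟩ : ∃ x₃, x₃ = l ^ 2 - x₁ - x₂ := ⟨_, rfl⟩
  obtain ⟨L, hL⟩ : ∃ L, L = (w₁ ^ 3 - w₂ ^ 3 - 2 * (x₁ * w₁ - x₂ * w₂)) /
    (2 * (w₁ - w₂) * (w₁ + w₂)) := ⟨_, rfl⟩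
  obtain ⟨A1, A2⟩ := alg hsub hw hw' hr hL hl hv hx₃
  have hx3X : (curveE₁ n).addX x₁ x₂ ((curveE₁ n).slope x₁ x₂ (x₁ * w₁) (x₂ * w₂)) = x₃ := by
    rw [hsl, ← hl]; simp only [Affine.addX, curveE₁]; rw [hx₃]; ring
  have hm : l - w₁ = x₂ * (w₁ - w₂) / (x₁ - x₂) := by rw [hl]; field_simp; ring
  have hx₃' : x₃ = x₁ * x₂ * ((w₁ - w₂) / (x₁ - x₂)) ^ 2 := by
    rw [hx₃, hl]
    field_simp
    linear_combination (x₁ - x₂) * hr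
  have hx₃0 : x₃ ≠ 0 := by
    rw [hx₃']
    exact mul_ne_zero (mul_ne_zero hx₁ hx₂) (pow_ne_zero _ (div_ne_zero hw hsub))
  have hy3 : (curveE₁ n).addY x₁ x₂ (x₁ * w₁)
      ((curveE₁ n).slope x₁ x₂ (x₁ * w₁) (x₂ * w₂)) = -(x₃ * v) := by
    rw [Affine.addY, Affine.negAddY, hx3X, hsl, ← hl]
    simp only [Affine.negY, curveE₁]
    have : x₃ * ((x₁ - x₂) / (w₁ - w₂)) = x₁ * x₂ * (w₁ - w₂) / (x₁ - x₂) := by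
      rw [hx₃']; field_simp
    have h5 : x₃ * v = x₃ * l - x₁ * x₂ * (w₁ - w₂) / (x₁ - x₂) := by rw [hv, mul_sub, this]
    rw [h5]
    have h6 : x₁ * x₂ * (w₁ - w₂) / (x₁ - x₂) = x₁ * (l - w₁) := by rw [hm]; ring
    rw [h6]; ring
  have f₃ : 4 * (n : ℚ) ^ 2 = x₃ * v ^ 2 - x₃ ^ 2 := by
    have h3 := Affine.nonsingular_add h₁ h₂ (fun h => hx h.1)
    rw [hx3X, hy3] at h3
    obtain ⟨e₃, -⟩ := curveE₁_nonsingular_iff.1 h3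
    apply mul_left_cancel₀ hx₃0; linear_combination - e₃
  have hSL : (curveE n).slope (w₁ ^ 2 / 4) (w₂ ^ 2 / 4) (w₁ * (w₁ ^ 2 - 2 * x₁) / 8)
      (w₂ * (w₂ ^ 2 - 2 * x₂) / 8) = L := by
    rw [X1, X2] at hX
    have : w₁ ^ 2 / 4 - w₂ ^ 2 / 4 = (w₁ - w₂) * (w₁ + w₂) / 4 := by ring
    rw [Affine.slope_of_X_ne hX, hL, this]
    field_simp
    ring
  have X3 : (-(x₃ * v)) ^ 2 / (4 * x₃ ^ 2) = v ^ 2 / 4 := by field_simp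
  have Y3 : (-(x₃ * v)) * (4 * n ^ 2 - x₃ ^ 2) / (8 * x₃ ^ 2) = -(v * (v ^ 2 - 2 * x₃) / 8) := by
    rw [f₃]; field_simp; ring
  rw [Affine.Point.add_of_X_ne hx, phiHatFun_some h₁ hx₁, phiHatFun_some h₂ hx₂,
    phiHatFun_some _ (by rw [hx3X]; exact hx₃0), Affine.Point.add_of_X_ne hX,
    Affine.Point.some.injEq, hx3X, hy3, X1, X2, Y1, Y2, X3, Y3, hSL]
  simp only [Affine.addY, Affine.negAddY, Affine.negY, Affine.addX, curveE]
  constructor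
  · rw [A1]; ring
  · rw [A2, A1]; ring

theorem phiHatFun_add (n : ℕ) (P Q : (curveE₁ n).Point) :
    phiHatFun n (P + Q) = phiHatFun n P + phiHatFun n Q := by
  match P, Q with
  | .zero, Q =>
    exact (congrArg _ (zero_add Q)).trans (zero_add _).symm
  | .some x y h, .zero =>
    exact (congrArg _ (add_zero _)).trans (add_zero _).symm
  | .some x₁ y₁ h₁, .some x₂ y₂ h₂ =>
    by_cases hx₁ : x₁ = 0
    · subst hx₁
      rw [phiHatFun_add_two_torsion', phiHatFun_some_zero, zero_add]
    by_cases hx₂ : x₂ = 0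
    · subst hx₂
      rw [add_comm, phiHatFun_add_two_torsion', phiHatFun_some_zero, add_zero]
    by_cases hx : x₁ = x₂
    · rcases Affine.Point.X_eq_iff (h₁ := h₁) (h₂ := h₂) |>.1 hx with h | h
      · rw [h, ← two_smul ℕ, ← two_smul ℕ, phiHatFun_two_smul]
      · rw [h, neg_add_cancel, phiHatFun_neg, neg_add_cancel, phiHatFun_zero]
    by_cases hxx : x₁ * x₂ = 4 * (n : ℚ) ^ 2
    · have hn : 4 * (n : ℚ) ^ 2 ≠ 0 := by rw [← hxx]; exact mul_ne_zero hx₁ hx₂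
      have h₀ : (curveE₁ n).Nonsingular 0 0 := by
        rw [curveE₁_nonsingular_iff]
        exact ⟨by ring, Or.inl (by simpa using hn)⟩
      have hne : (0 : ℚ) ≠ x₁ := Ne.symm hx₁
      have hT := Affine.Point.add_of_X_ne (h₁ := h₀) (h₂ := h₁) hne
      have hX : (curveE₁ n).addX 0 x₁ ((curveE₁ n).slope 0 x₁ 0 y₁) = x₂ := by
        rw [Affine.slope_of_X_ne hne]
        simp only [Affine.addX, curveE₁]
        have e₁ := (curveE₁_nonsingular_iff.1 h₁).1
        field_simp
        linear_combination e₁ - x₁ * hxx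
      have hcases := (Affine.Point.X_eq_iff (h₁ := h₂)
        (h₂ := Affine.nonsingular_add h₀ h₁ (fun h => hne h.1))).1 hX.symm
      rw [← hT] at hcases
      rcases hcases with h | h
      · rw [h, add_left_comm, phiHatFun_add_two_torsion', phiHatFun_add_two_torsion',
          ← two_smul ℕ, ← two_smul ℕ, phiHatFun_two_smul]
      · rw [h, phiHatFun_neg, phiHatFun_add_two_torsion', add_neg_cancel, neg_add_rev,
          add_neg_cancel_left, phiHatFun_neg, phiHatFun_some_zero, neg_zero]
    · exact phiHatFun_add_generic h₁ h₂ hx₁ hx₂ hx hxx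

/-- The dual isogeny `φ̂₁` on rational points, as a group homomorphism `E_{1,n}(ℚ) → E_n(ℚ)`. -/
noncomputable def phiHat (n : ℕ) : (curveE₁ n).Point →+ (curveE n).Point where
  toFun := phiHatFun n
  map_zero' := phiHatFun_zero n
  map_add' := phiHatFun_add n

/-- `φ̂₁(E_{1,n}(ℚ))` contains `2 E_n(ℚ)`. -/
theorem two_nsmul_mem_range_phiHat (n : ℕ) (P : (curveE n).Point) :
    2 • P ∈ (phiHat n).range :=
  ⟨phiFun n P, phiHatFun_phiFun n P⟩

/-- The structure of an `𝔽₂`-vector space on `E_n(ℚ)/φ̂₁(E_{1,n}(ℚ))`. -/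
noncomputable instance moduleQuotientRangePhiHat (n : ℕ) :
    Module (ZMod 2) ((curveE n).Point ⧸ (phiHat n).range) :=
  QuotientAddGroup.zmodModule (two_nsmul_mem_range_phiHat n)

/-- The torsion subgroup `T` of `E_n(ℚ)`. -/
abbrev torsionE (n : ℕ) : AddSubgroup (curveE n).Point :=
  AddCommGroup.torsion (curveE n).Point

/-- The torsion subgroup `T₁` of `E_{1,n}(ℚ)`. -/
abbrev torsionE₁ (n : ℕ) : AddSubgroup (curveE₁ n).Point :=
  AddCommGroup.torsion (curveE₁ n).Point

/-- A choice of subgroups `A ⊆ E_n(ℚ)` and `A₁ ⊆ E_{1,n}(ℚ)` such that `E_n(ℚ)` is the internal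
direct sum of `T` and `A`, `E_{1,n}(ℚ)` is the internal direct sum of `T₁` and `A₁`, and
`φ̂₁(A₁) ⊆ A`. -/
structure TorsionSplitting (n : ℕ) where
  A : AddSubgroup (curveE n).Point
  A₁ : AddSubgroup (curveE₁ n).Point
  isCompl : IsCompl (torsionE n) A
  isCompl₁ : IsCompl (torsionE₁ n) A₁
  map_le : A₁.map (phiHat n) ≤ A

namespace TorsionSplitting

/-- `φ̂₁(A₁)`, as a subgroup of `A`. -/
noncomputable def image {n : ℕ} (D : TorsionSplitting n) : AddSubgroup D.A :=
  (D.A₁.map (phiHat n)).addSubgroupOf D.A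

theorem two_nsmul_mem_image {n : ℕ} (D : TorsionSplitting n) (a : D.A) : 2 • a ∈ D.image := by
  have htop : phiFun n a ∈ torsionE₁ n ⊔ D.A₁ := by
    rw [D.isCompl₁.sup_eq_top]; trivial
  obtain ⟨t, ht, b, hb, htb⟩ := AddSubgroup.mem_sup.1 htop
  have h2 : phiHat n t + phiHat n b = 2 • (a : (curveE n).Point) := by
    rw [← map_add, htb]; exact phiHatFun_phiFun n a
  have hbA : phiHat n b ∈ D.A := D.map_le ⟨b, hb, rfl⟩
  have htA : phiHat n t ∈ D.A := by
    rw [eq_sub_of_add_eq h2]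
    exact D.A.sub_mem (D.A.nsmul_mem a.2 2) hbA
  have htT : phiHat n t ∈ torsionE n := (phiHat n).isOfFinAddOrder ht
  have h0 : phiHat n t = 0 := (AddSubgroup.disjoint_def.1 D.isCompl.disjoint) htT htA
  rw [image, AddSubgroup.mem_addSubgroupOf]
  refine ⟨b, hb, ?_⟩
  rw [h0, zero_add] at h2
  simpa using h2

/-- The structure of an `𝔽₂`-vector space on `A/φ̂₁(A₁)`. -/
noncomputable instance {n : ℕ} (D : TorsionSplitting n) : Module (ZMod 2) (D.A ⧸ D.image) :=
  QuotientAddGroup.zmodModule D.two_nsmul_mem_image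

end TorsionSplitting

/-- The subgroup `E_n(ℚ)[2]`. -/
abbrev twoTorsionE (n : ℕ) : AddSubgroup (curveE n).Point :=
  AddSubgroup.torsionBy (curveE n).Point 2

theorem twoTorsionE_le (n : ℕ) : twoTorsionE n ≤ torsionE n := fun _ hP =>
  isOfFinAddOrder_iff_nsmul_eq_zero.2
    ⟨2, two_pos, AddSubgroup.torsionBy.nsmul_iff.1 hP⟩

/-- The inclusion `E_n(ℚ)[2] → T`. -/
def twoTorsionInclusion (n : ℕ) : twoTorsionE n →+ torsionE n :=
  AddSubgroup.inclusion (twoTorsionE_le n)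

/-- `φ̂₁(T₁)`, as a subgroup of `T` (note that `φ̂₁(T₁) ⊆ T`). -/
noncomputable def torsionImage (n : ℕ) : AddSubgroup (torsionE n) :=
  ((torsionE₁ n).map (phiHat n)).addSubgroupOf (torsionE n)

/-!
Let `G = E_n(ℚ)` and `B = φ̂₁(E_{1,n}(ℚ))`, so `2G ⊆ B`. With `u = x(P) / n`, doubling a point `P`
of `E_n` with `y(P) ≠ 0` strictly lowers the `2`-adic valuation of `u` and makes it negative, so
that `2P` again has `y ≠ 0`; hence `T = E_n[2]`, of order four. A point of `E_{1,n}` outside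
`{∞, (0,0)}` that `φ̂₁` sends into `E_n[2]` would have `x = ±2n` and `y² = ±16n³`, which is
impossible as `n` is not a square. So `B` meets `T` trivially and `ker φ̂₁ = T₁`. In the
`𝔽₂`-vector space `G / B` the image of `T` has a complement, whose preimage is an `A ⊇ B`; since `B`
is free, `φ̂₁ : E_{1,n}(ℚ) → B` splits, which gives `A₁`.

For any such `A` and `A₁`, `φ̂₁` maps `A₁` isomorphically onto `B`, and
`[G : B] = [A : B] · |T|`, `[G : 2G] = [A : 2A] · |T|` with `|T| = 4 = 2²`.
Finite generation is the Mordell–Weil theorem for curves with full rational `2`-torsion: `x - e`,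
`x - f` and `x - h` take finitely many values modulo squares, `2G` is where they are squares, and
the parallelogram law up to a bounded error for the height of `x` allows descent.
-/

section AbelianGroup

variable {G : Type*} [AddCommGroup G]

theorem index_eq_natCard_of_isCompl {T A : AddSubgroup G} (h : IsCompl T A) :
    A.index = Nat.card T :=
  calc A.index = A.relIndex (T ⊔ A) := by rw [h.sup_eq_top, AddSubgroup.relIndex_top_right]
    _ = (A ⊓ T).relIndex T := by
      rw [AddSubgroup.relIndex_sup_right, AddSubgroup.inf_relIndex_right]
    _ = Nat.card T := by
      rw [inf_comm, h.inf_eq_bot, AddSubgroup.relIndex_bot_left]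

theorem index_eq_relIndex_mul_natCard_of_isCompl {T A B : AddSubgroup G} (h : IsCompl T A)
    (hBA : B ≤ A) : B.index = B.relIndex A * Nat.card T := by
  rw [← AddSubgroup.relIndex_mul_index hBA, index_eq_natCard_of_isCompl h]

theorem finiteIndex_of_finite_cover {H : AddSubgroup G} {ι : Type*} {D : Set ι} (hD : D.Finite)
    {C : ι → Set G} (hC : ∀ i ∈ D, ∀ P ∈ C i, ∀ Q ∈ C i, P - Q ∈ H)
    (hcover : ∀ P ∉ H, ∃ i ∈ D, P ∈ C i) : H.FiniteIndex := by
  have hclass : ∀ i ∈ D, (QuotientAddGroup.mk' H '' C i).Finite := fun i hi =>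
    Set.Subsingleton.finite <| by
      rintro _ ⟨P, hP, rfl⟩ _ ⟨Q, hQ, rfl⟩
      exact QuotientAddGroup.eq_iff_sub_mem.2 (hC i hi P hP Q hQ)
  have huniv : (Set.univ : Set (G ⧸ H)) ⊆ {0} ∪ ⋃ i ∈ D, QuotientAddGroup.mk' H '' C i := by
    intro q _
    obtain ⟨P, rfl⟩ := QuotientAddGroup.mk'_surjective H q
    by_cases hP : P ∈ H
    · exact .inl ((QuotientAddGroup.eq_zero_iff P).2 hP)
    · obtain ⟨i, hi, hPi⟩ := hcover P hP
      exact .inr (Set.mem_biUnion hi ⟨P, hPi, rfl⟩)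
  have : Finite (G ⧸ H) := Set.finite_univ_iff.1 <|
    ((Set.finite_singleton 0).union (hD.biUnion hclass)).subset huniv
  exact AddSubgroup.finiteIndex_of_finite_quotient

theorem natCard_modN (n : ℕ) :
    Nat.card (ModN G n) = (nsmulAddMonoidHom (α := G) n).range.index := by
  have hrange : (LinearMap.range (LinearMap.lsmul ℤ G (n : ℤ))).toAddSubgroup =
      (nsmulAddMonoidHom (α := G) n).range := by
    ext x
    simp only [Submodule.mem_toAddSubgroup, LinearMap.mem_range, AddMonoidHom.mem_range,
      LinearMap.lsmul_apply, natCast_zsmul, nsmulAddMonoidHom_apply]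
  rw [← hrange]
  exact (AddSubgroup.index_eq_card _).symm

theorem natCard_modN_of_isCompl {T A : AddSubgroup G} (h : IsCompl T A) {n : ℕ}
    (hT : ∀ t ∈ T, n • t = 0) : Nat.card (ModN G n) = Nat.card (ModN A n) * Nat.card T := by
  have hmap : A.map (nsmulAddMonoidHom n) = (nsmulAddMonoidHom n).range :=
    AddSubgroup.map_eq_range_iff.2 (h.symm.codisjoint.mono_right fun t ht => hT t ht)
  have hle : A.map (nsmulAddMonoidHom n) ≤ A := by
    rintro _ ⟨a, ha, rfl⟩
    exact A.nsmul_mem ha n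
  rw [natCard_modN, natCard_modN, ← AddSubgroup.addSubgroupOf_map_nsmulAddMonoidHom_eq_range,
    ← hmap]
  exact index_eq_relIndex_mul_natCard_of_isCompl h hle

theorem finrank_modN_eq_finrank (p : ℕ) [Fact p.Prime] [Module.Free ℤ G] [Module.Finite ℤ G] :
    Module.finrank (ZMod p) (ModN G p) = Module.finrank ℤ G := by
  refine Nat.pow_right_injective (Fact.out : p.Prime).two_le ?_
  have : NeZero p := ⟨(Fact.out : p.Prime).ne_zero⟩
  have : Finite (ModN G p) := Nat.finite_of_card_ne_zero <| by
    rw [ModN.natCard_eq]; exact pow_ne_zero _ (NeZero.ne p)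
  have hcard := Module.natCard_eq_pow_finrank (K := ZMod p) (V := ModN G p)
  rw [ModN.natCard_eq, Nat.card_zmod] at hcard
  exact hcard.symm

theorem finrank_eq_add_of_natCard_eq_mul_pow {p : ℕ} [Fact p.Prime] {V W : Type*}
    [AddCommGroup V] [Module (ZMod p) V] [AddCommGroup W] [Module (ZMod p) W] [Finite V] {k : ℕ}
    (h : Nat.card V = Nat.card W * p ^ k) :
    Module.finrank (ZMod p) V = Module.finrank (ZMod p) W + k := by
  have : Finite W := Nat.finite_of_card_ne_zero (left_ne_zero_of_mul (h ▸ Nat.card_pos.ne'))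
  rw [Module.natCard_eq_pow_finrank (K := ZMod p) (V := V),
    Module.natCard_eq_pow_finrank (K := ZMod p) (V := W), Nat.card_zmod, ← pow_add] at h
  exact Nat.pow_right_injective (Fact.out : p.Prime).two_le h

theorem isAddTorsionFree_of_disjoint_torsion {A : AddSubgroup G}
    (h : Disjoint (AddCommGroup.torsion G) A) : IsAddTorsionFree A := by
  rw [AddCommGroup.isAddTorsionFree_iff_torsion_eq_bot, eq_bot_iff]
  intro a ha
  exact Subtype.ext (AddSubgroup.disjoint_def.1 h (A.subtype.isOfFinAddOrder ha) a.2)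

theorem exists_isCompl_ge_of_nsmul_mem {p : ℕ} [Fact p.Prime] {T B : AddSubgroup G}
    (hB : ∀ g : G, p • g ∈ B) (hTB : Disjoint T B) :
    ∃ A : AddSubgroup G, IsCompl T A ∧ B ≤ A := by
  let : Module (ZMod p) (G ⧸ B) := QuotientAddGroup.zmodModule hB
  let π := QuotientAddGroup.mk' B
  have hker : π.ker = B := QuotientAddGroup.ker_mk' B
  obtain ⟨C, hC⟩ : ∃ C, IsCompl (T.map π) C := by
    obtain ⟨V, hV⟩ := (AddSubgroup.toZModSubmodule p (T.map π)).exists_isCompl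
    exact ⟨V.toAddSubgroup, (AddSubgroup.toZModSubmodule p).symm.isCompl hV⟩
  have hBA : B ≤ C.comap π := hker.ge.trans (AddSubgroup.ker_le_comap π C)
  refine ⟨C.comap π, ⟨?_, codisjoint_iff.2 ?_⟩, hBA⟩
  · refine AddSubgroup.disjoint_def.2 fun {x} hxT hxA => AddSubgroup.disjoint_def.1 hTB hxT ?_
    rw [← hker]
    exact AddSubgroup.disjoint_def.1 hC.disjoint (AddSubgroup.mem_map_of_mem π hxT) hxA
  · calc T ⊔ C.comap π = (T.map π).comap π ⊔ C.comap π := by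
          rw [AddSubgroup.comap_map_eq, hker, sup_assoc, sup_eq_right.2 hBA]
      _ = ⊤ := by
          rw [AddSubgroup.comap_sup_eq _ _ _ (QuotientAddGroup.mk'_surjective B), hC.sup_eq_top,
            AddSubgroup.comap_top]

theorem exists_isCompl_ker_of_free {H : Type*} [AddCommGroup H] [Module.Free ℤ H] (f : G →+ H)
    (hf : Function.Surjective f) : ∃ A : AddSubgroup G, IsCompl f.ker A := by
  obtain ⟨s, hs⟩ := Module.projective_lifting_property f.toIntLinearMap LinearMap.id hf
  have hfs (y : H) : f (s y) = y := LinearMap.congr_fun hs y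
  refine ⟨s.toAddMonoidHom.range, ⟨?_, ?_⟩⟩
  · rw [AddSubgroup.disjoint_def]
    rintro _ hx ⟨y, rfl⟩
    have hy : y = 0 := (hfs y).symm.trans hx
    rw [hy, map_zero]
  · rw [codisjoint_iff, eq_top_iff]
    intro x _
    refine AddSubgroup.mem_sup.2 ⟨x - s (f x), ?_, s (f x), ⟨f x, rfl⟩, sub_add_cancel _ _⟩
    rw [AddMonoidHom.mem_ker, map_sub, hfs, sub_self]

theorem nonempty_addEquiv_range_of_isCompl_ker {H : Type*} [AddCommGroup H] {f : G →+ H}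
    {A : AddSubgroup G} (h : IsCompl f.ker A) : Nonempty (A ≃+ f.range) :=
  ⟨(LinearMap.kerComplementEquivRange f.toIntLinearMap
    (AddSubgroup.toIntSubmodule.isCompl h.symm)).toAddEquiv⟩

theorem not_isOfFinAddOrder_of_nsmul_lt {α : Type*} [Preorder α] {S : Set G} {m : ℕ}
    {v : G → α} (hS : ∀ P ∈ S, m • P ∈ S ∧ v (m • P) < v P) {P : G} (hP : P ∈ S) :
    ¬ IsOfFinAddOrder P := by
  intro hfin
  have hfinite : ((AddSubmonoid.multiples P : Set G) ∩ S).Finite :=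
    (finite_multiples.2 hfin).inter_of_left S
  obtain ⟨Q, ⟨hQP, hQS⟩, hmin⟩ := hfinite.exists_minimalFor v _
    ⟨P, AddSubmonoid.mem_multiples P, hP⟩
  obtain ⟨hmQ, hlt⟩ := hS Q hQS
  exact hlt.not_ge (hmin ⟨nsmul_mem hQP m, hmQ⟩ hlt.le)

end AbelianGroup

/-! ### Heights -/

section Height

open Height MvPolynomial

theorem eval_addSubMap {R : Type*} [CommRing R] (W : WeierstrassCurve R) (s t u : R) :
    (fun i => (addSubMap W i).eval ![s, t, u]) =
      ![s ^ 2 - W.b₄ * s * u - W.b₆ * t * u - W.b₈ * u ^ 2,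
        2 * t * s + W.b₂ * s * u + W.b₄ * t * u + W.b₆ * u ^ 2, t ^ 2 - 4 * s * u] := by
  ext i
  fin_cases i <;> simp [addSubMap]

variable {F : Type*} [Field F] {W : Affine F}

theorem eval_addSubMap_sym2x_zero_left (Q : W.Point) :
    (fun i => (addSubMap W i).eval ((0 : W.Point).sym2x Q)) = Q.sym2x Q := by
  match Q with
  | 0 =>
    rw [Affine.Point.sym2x_zero_zero, eval_addSubMap]
    simp only [Matrix.vecCons_inj, and_true]
    refine ⟨?_, ?_, ?_⟩ <;> ring
  | .some x y h =>
    rw [Affine.Point.sym2x_zero_some, Affine.Point.sym2x_some_some, eval_addSubMap]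
    simp only [Matrix.vecCons_inj, and_true]
    refine ⟨?_, ?_, ?_⟩ <;> ring

theorem northcott_logHeight_xRep [AdmissibleAbsValues F] [Northcott (logHeight₁ (K := F))] :
    Northcott fun P : W.Point => logHeight P.xRep := by
  refine ⟨fun B => ?_⟩
  have hfib (v : Fin 2 → F) : {P : W.Point | P.xRep = v}.Finite := by
    rcases Set.eq_empty_or_nonempty {P : W.Point | P.xRep = v} with h | ⟨P, rfl⟩
    · exact h ▸ Set.finite_empty
    · exact (Set.toFinite {P, -P}).subset fun Q => Affine.Point.eq_or_eq_neg_of_xRep_eq_xRep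
  have hfin : (insert ![1, 0] ((fun x : F => ![x, 1]) '' {x | logHeight₁ x ≤ B})).Finite :=
    ((Northcott.finite_le B).image _).insert _
  refine (hfin.preimage' fun v _ => hfib v).subset fun P hP => ?_
  match P with
  | 0 => exact .inl rfl
  | .some x y h => exact .inr ⟨x, (logHeight₁_eq_logHeight x).trans_le hP, rfl⟩

theorem exists_forall_abs_logHeight_sym2x_sub_le [AdmissibleAbsValues F] (W : Affine F) :
    ∃ C : ℝ, ∀ P Q : W.Point, |logHeight (P.sym2x Q) - (logHeight P.xRep + logHeight Q.xRep)| ≤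
      C := by
  obtain ⟨C, hC⟩ := abs_logHeight_sym2_sub_le F
  have hvec (v : Fin 2 → F) : ![v 0, v 1] = v := FinVec.etaExpand_eq v
  refine ⟨C, fun P Q => ?_⟩
  have h := hC (a := P.xRep 0) (b := P.xRep 1) (c := Q.xRep 0) (d := Q.xRep 1)
    (by rw [hvec]; exact P.xRep_ne_zero) (by rw [hvec]; exact Q.xRep_ne_zero)
  rwa [hvec, hvec] at h

variable [DecidableEq F]

theorem eval_addSubMap_sym2x_self_of_Y_ne {x y : F} (h : W.Nonsingular x y)
    (hy : y ≠ W.negY x y) :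
    (fun i => (addSubMap W i).eval ((Affine.Point.some x y h).sym2x (.some x y h))) =
      (y - W.negY x y) ^ 2 • (Affine.Point.some x y h + .some x y h).sym2x 0 := by
  have heq := (Affine.equation_iff' ..).1 h.1
  have hd : y - W.negY x y ≠ 0 := sub_ne_zero.2 hy
  have hX : (y - W.negY x y) ^ 2 * W.addX x x ((3 * x ^ 2 + 2 * W.a₂ * x + W.a₄ - W.a₁ * y) /
      (y - W.negY x y)) = (3 * x ^ 2 + 2 * W.a₂ * x + W.a₄ - W.a₁ * y) ^ 2 +
        W.a₁ * (3 * x ^ 2 + 2 * W.a₂ * x + W.a₄ - W.a₁ * y) * (y - W.negY x y) -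
        (W.a₂ + 2 * x) * (y - W.negY x y) ^ 2 := by
    rw [Affine.addX]
    field_simp
    ring
  rw [Affine.Point.add_self_of_Y_ne hy, Affine.Point.sym2x_some_zero, Affine.Point.sym2x_some_some,
    eval_addSubMap, Affine.slope_of_Y_ne rfl hy]
  simp only [Matrix.smul_cons, Matrix.smul_empty, smul_eq_mul, Matrix.vecCons_inj, and_true, hX]
  simp only [WeierstrassCurve.b₂, WeierstrassCurve.b₄, WeierstrassCurve.b₆, WeierstrassCurve.b₈,
    Affine.negY]
  refine ⟨?_, ?_, ?_⟩
  · grind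
  · linear_combination -4 * heq
  · ring

theorem eval_addSubMap_sym2x_self_of_Y_eq [W.IsElliptic] {x y : F} (h : W.Nonsingular x y)
    (hy : y = W.negY x y) : ∃ c : F, c ≠ 0 ∧
      (fun i => (addSubMap W i).eval ((Affine.Point.some x y h).sym2x (.some x y h))) =
        c • (Affine.Point.some x y h + .some x y h).sym2x 0 := by
  have heq := (Affine.equation_iff' ..).1 h.1
  rw [Affine.Point.add_self_of_Y_eq hy, Affine.Point.sym2x_zero_zero]
  have hψ : 2 * y + W.a₁ * x + W.a₃ = 0 := by
    rw [Affine.negY] at hy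
    linear_combination hy
  let c := (x * x) ^ 2 - W.b₄ * (x * x) * 1 - W.b₆ * (x + x) * 1 - W.b₈ * 1 ^ 2
  have hc : (fun i => (addSubMap W i).eval ((Affine.Point.some x y h).sym2x (.some x y h))) =
      c • ![1, 0, 0] := by
    rw [Affine.Point.sym2x_some_some, eval_addSubMap]
    simp only [Matrix.smul_cons, Matrix.smul_empty, smul_eq_mul, Matrix.vecCons_inj, and_true]
    simp only [WeierstrassCurve.b₂, WeierstrassCurve.b₄, WeierstrassCurve.b₆]
    refine ⟨(mul_one c).symm, ?_, by ring⟩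
    linear_combination (2 * y + W.a₁ * x + W.a₃) * hψ - 4 * heq
  refine ⟨c, fun h0 => ?_, hc⟩
  exact addSubMap_ne_zero W (Affine.Point.sym2x_ne_zero _ _) (by rw [hc, h0, zero_smul])

theorem eval_addSubMap_sym2x_of_X_ne {x₁ x₂ y₁ y₂ : F} (h₁ : W.Nonsingular x₁ y₁)
    (h₂ : W.Nonsingular x₂ y₂) (hx : x₁ ≠ x₂) :
    (fun i => (addSubMap W i).eval ((Affine.Point.some x₁ y₁ h₁).sym2x (.some x₂ y₂ h₂))) =
      (x₁ - x₂) ^ 2 • (Affine.Point.some x₁ y₁ h₁ + .some x₂ y₂ h₂).sym2x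
        (.some x₁ y₁ h₁ - .some x₂ y₂ h₂) := by
  have e₁ := (Affine.equation_iff' ..).1 h₁.1
  have e₂ := (Affine.equation_iff' ..).1 h₂.1
  have hd : x₁ - x₂ ≠ 0 := sub_ne_zero.2 hx
  have hX (y : F) : (x₁ - x₂) ^ 2 * W.addX x₁ x₂ ((y₁ - y) / (x₁ - x₂)) =
      (y₁ - y) ^ 2 + W.a₁ * (y₁ - y) * (x₁ - x₂) - (W.a₂ + x₁ + x₂) * (x₁ - x₂) ^ 2 := by
    rw [Affine.addX]
    field_simp
    ring
  rw [sub_eq_add_neg (Affine.Point.some x₁ y₁ h₁), Affine.Point.neg_some,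
    Affine.Point.add_of_X_ne hx, Affine.Point.add_of_X_ne hx, Affine.Point.sym2x_some_some,
    Affine.Point.sym2x_some_some, eval_addSubMap, Affine.slope_of_X_ne hx,
    Affine.slope_of_X_ne hx]
  simp only [Matrix.smul_cons, Matrix.smul_empty, smul_eq_mul, Matrix.vecCons_inj, and_true,
    mul_add, hX]
  simp only [WeierstrassCurve.b₂, WeierstrassCurve.b₄, WeierstrassCurve.b₆, WeierstrassCurve.b₈]
  refine ⟨?_, ?_, ?_⟩
  · apply mul_left_cancel₀ (pow_ne_zero 2 hd)
    calc _ = ((x₁ - x₂) ^ 2 * W.addX x₁ x₂ ((y₁ - y₂) / (x₁ - x₂))) *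
          ((x₁ - x₂) ^ 2 * W.addX x₁ x₂ ((y₁ - W.negY x₂ y₂) / (x₁ - x₂))) := ?_
      _ = _ := by ring
    rw [hX, hX, Affine.negY]
    grind
  · rw [Affine.negY]
    linear_combination -2 * e₁ - 2 * e₂
  · ring

theorem exists_eval_addSubMap_sym2x_eq_smul [W.IsElliptic] (P Q : W.Point) : ∃ c : F, c ≠ 0 ∧
    (fun i => (addSubMap W i).eval (P.sym2x Q)) = c • (P + Q).sym2x (P - Q) := by
  have hself (P : W.Point) : ∃ c : F, c ≠ 0 ∧
      (fun i => (addSubMap W i).eval (P.sym2x P)) = c • (P + P).sym2x 0 := by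
    match P with
    | 0 => exact ⟨1, one_ne_zero, by rw [eval_addSubMap_sym2x_zero_left, add_zero, one_smul]⟩
    | .some x y h =>
      by_cases hy : y = W.negY x y
      · exact eval_addSubMap_sym2x_self_of_Y_eq h hy
      · exact ⟨_, pow_ne_zero 2 (sub_ne_zero.2 hy), eval_addSubMap_sym2x_self_of_Y_ne h hy⟩
  match P, Q with
  | 0, Q =>
    refine ⟨1, one_ne_zero, ?_⟩
    rw [eval_addSubMap_sym2x_zero_left, zero_add, zero_sub, Affine.Point.sym2x_neg_right, one_smul]
  | .some x y h, 0 =>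
    refine ⟨1, one_ne_zero, ?_⟩
    rw [Affine.Point.sym2x_comm, eval_addSubMap_sym2x_zero_left, add_zero, sub_zero, one_smul]
  | .some x₁ y₁ h₁, .some x₂ y₂ h₂ =>
    by_cases hx : x₁ = x₂
    · obtain ⟨c, hc, e⟩ := hself (.some x₁ y₁ h₁)
      refine ⟨c, hc, ?_⟩
      rcases Affine.Point.X_eq_iff.1 hx with h | h
      · rw [← h, sub_self, e]
      · rw [← neg_eq_iff_eq_neg.2 h, Affine.Point.sym2x_neg_right, sub_neg_eq_add, add_neg_cancel,
          Affine.Point.sym2x_comm 0, e]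
    · exact ⟨_, pow_ne_zero 2 (sub_ne_zero.2 hx), eval_addSubMap_sym2x_of_X_ne h₁ h₂ hx⟩

theorem exists_forall_abs_logHeight_add_sub_le [AdmissibleAbsValues F] (W : Affine F)
    [W.IsElliptic] :
    ∃ C : ℝ, ∀ P Q : W.Point, |logHeight (P + Q).xRep + logHeight (P - Q).xRep -
      2 * (logHeight P.xRep + logHeight Q.xRep)| ≤ C := by
  obtain ⟨C₁, h₁⟩ := abs_logHeight_addSubMap_sub_two_mul_logHeight_le W
  obtain ⟨C₂, h₂⟩ := exists_forall_abs_logHeight_sym2x_sub_le W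
  refine ⟨C₁ + 3 * C₂, fun P Q => ?_⟩
  obtain ⟨c, hc, e⟩ := exists_eval_addSubMap_sym2x_eq_smul P Q
  have hF := h₁ (P.sym2x Q)
  rw [e, logHeight_smul_eq_logHeight _ hc] at hF
  have hPQ := h₂ P Q
  have hsum := h₂ (P + Q) (P - Q)
  rw [abs_le] at *
  constructor <;> linarith

theorem fg_point_of_finiteIndex_range_two_nsmul [AdmissibleAbsValues F]
    [Northcott (logHeight₁ (K := F))] [W.IsElliptic]
    (h : (nsmulAddMonoidHom (α := W.Point) 2).range.FiniteIndex) : AddGroup.FG W.Point := by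
  have := northcott_logHeight_xRep (W := W)
  obtain ⟨C, hC⟩ := exists_forall_abs_logHeight_add_sub_le W
  exact AddCommGroup.fg_of_descent' h (fun P => logHeight_nonneg P.xRep) hC

end Height

/-! ### Descent by square classes -/

theorem exists_eq_mul_sq_of_mul_eq_sq {a b c : ℤ} (h : a * b = c ^ 2) :
    ∃ d s : ℤ, d.natAbs = Int.gcd a b ∧ a = d * s ^ 2 := by
  rcases (Int.gcd a b).eq_zero_or_pos with h0 | hpos
  · exact ⟨0, 0, h0.symm, by rw [(Int.gcd_eq_zero_iff.1 h0).1]; ring⟩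
  obtain ⟨a', ha⟩ := Int.gcd_dvd_left a b
  obtain ⟨b', hb⟩ := Int.gcd_dvd_right a b
  set g : ℤ := ((Int.gcd a b : ℕ) : ℤ) with hg
  have hg0 : g ≠ 0 := Int.natCast_ne_zero.2 hpos.ne'
  have hcop : Int.gcd a' b' = 1 := by
    refine Nat.eq_of_mul_eq_mul_left hpos ?_
    rw [mul_one, ← Int.natAbs_natCast (Int.gcd a b), ← Int.gcd_mul_left, ← hg, ← ha, ← hb,
      hg, Int.natAbs_natCast]
  obtain ⟨c', rfl⟩ : g ∣ c := (Int.pow_dvd_pow_iff two_ne_zero).1 ⟨a' * b', by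
    rw [← h, ha, hb]; ring⟩
  have hab : a' * b' = c' ^ 2 := mul_left_cancel₀ (pow_ne_zero 2 hg0) (by
    rw [← mul_pow, ← h, ha, hb]; ring)
  obtain ⟨s, hs | hs⟩ := Int.sq_of_gcd_eq_one hcop hab
  · exact ⟨g, s, Int.natAbs_natCast _, by rw [ha, hs]⟩
  · exact ⟨-g, s, by rw [Int.natAbs_neg, Int.natAbs_natCast], by rw [ha, hs]; ring⟩

theorem gcd_mul_sub_dvd {u w : ℤ} (huw : IsCoprime u w) (e f h : ℤ) :
    (Int.gcd (w * (u - e * w)) ((u - f * w) * (u - h * w)) : ℤ) ∣ (e - f) * (e - h) := by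
  have hcop (m : ℤ) : IsCoprime (u - m * w) w := by
    rw [sub_eq_add_neg, ← neg_mul]
    exact huw.add_mul_right_left (-m)
  have hL := Int.gcd_dvd_left (w * (u - e * w)) ((u - f * w) * (u - h * w))
  have hR := Int.gcd_dvd_right (w * (u - e * w)) ((u - f * w) * (u - h * w))
  generalize (Int.gcd (w * (u - e * w)) ((u - f * w) * (u - h * w)) : ℤ) = g at hL hR
  have hgw : IsCoprime g w := ((hcop f).mul_left (hcop h)).of_isCoprime_of_dvd_left hR
  have hge : g ∣ u - e * w := hgw.dvd_of_dvd_mul_left hL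
  have hgw2 : g ∣ (e - f) * (e - h) * w ^ 2 := by
    have := dvd_sub hR (hge.mul_right ((u - f * w) + (e - h) * w))
    ring_nf at this ⊢
    exact this
  exact (hgw.pow_right (n := 2)).dvd_of_dvd_mul_right hgw2

/-- Two elements of a field have the same square class if they differ by the square of a nonzero
element; `0` forms a class of its own. -/
def SameSquareClass {F : Type*} [Field F] (a b : F) : Prop :=
  ∃ s : F, s ≠ 0 ∧ a = b * s ^ 2

theorem SameSquareClass.symm {F : Type*} [Field F] {a b : F} (h : SameSquareClass a b) :
    SameSquareClass b a := by
  obtain ⟨s, hs, rfl⟩ := h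
  exact ⟨s⁻¹, inv_ne_zero hs, by field_simp⟩

theorem SameSquareClass.trans {F : Type*} [Field F] {a b c : F} (hab : SameSquareClass a b)
    (hbc : SameSquareClass b c) : SameSquareClass a c := by
  obtain ⟨s, hs, rfl⟩ := hab
  obtain ⟨t, ht, rfl⟩ := hbc
  exact ⟨t * s, mul_ne_zero ht hs, by ring⟩

theorem exists_intCast_sameSquareClass_sub {e f h : ℤ} (hef : e ≠ f) (heh : e ≠ h) {x y : ℚ}
    (hxy : y ^ 2 = (x - e) * (x - f) * (x - h)) :
    ∃ d : ℤ, |d| ≤ |(e - f) * (e - h)| ∧ SameSquareClass (x - e) d := by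
  by_cases hx : x = e
  · exact ⟨0, by rw [abs_zero]; positivity, 1, one_ne_zero, by rw [hx]; simp⟩
  obtain ⟨u, w, huw, hw, hxu⟩ : ∃ u w : ℤ, IsCoprime u w ∧ (w : ℚ) ≠ 0 ∧ x * w = u :=
    ⟨x.num, x.den, Rat.isCoprime_num_den x, by exact_mod_cast x.den_nz, Rat.mul_den_eq_num x⟩
  have hsub (m : ℤ) : ((u - m * w : ℤ) : ℚ) = (x - m) * w := by
    push_cast
    rw [sub_mul, hxu]
  have hsq : IsSquare (((w * (u - e * w)) * ((u - f * w) * (u - h * w)) : ℤ) : ℚ) := by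
    refine ⟨y * w ^ 2, ?_⟩
    rw [Int.cast_mul, Int.cast_mul, Int.cast_mul, hsub, hsub, hsub]
    linear_combination -(w : ℚ) ^ 4 * hxy
  obtain ⟨c, hc⟩ := Rat.isSquare_intCast_iff.1 hsq
  obtain ⟨d, s, hd, hs⟩ := exists_eq_mul_sq_of_mul_eq_sq (hc.trans (sq c).symm)
  have hxs : (x - e) * w ^ 2 = d * s ^ 2 := by
    have := congrArg (Int.cast (R := ℚ)) hs
    rw [Int.cast_mul, hsub] at this
    push_cast at this
    linear_combination this
  have hs0 : (s : ℚ) ≠ 0 := fun h0 => by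
    rw [h0, zero_pow two_ne_zero, mul_zero] at hxs
    exact mul_ne_zero (sub_ne_zero.2 hx) (pow_ne_zero 2 hw) hxs
  refine ⟨d, ?_, s / w, div_ne_zero hs0 hw, by field_simp; exact hxs⟩
  have hdvd := gcd_mul_sub_dvd huw e f h
  rw [← hd, Int.natAbs_dvd] at hdvd
  exact Int.le_of_dvd (abs_pos.2 (mul_ne_zero (sub_ne_zero.2 hef) (sub_ne_zero.2 heh)))
    ((abs_dvd_abs _ _).2 hdvd)

section SplitCurve

variable {F : Type*} [Field F] {e f h : F}

/-- The Weierstrass curve `y² = (x - e)(x - f)(x - h)`, whose `2`-torsion is rational. -/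
def splitCurve (e f h : F) : Affine F :=
  ⟨0, -(e + f + h), 0, e * f + e * h + f * h, -(e * f * h)⟩

theorem splitCurve_equation_iff {x y : F} :
    (splitCurve e f h).Equation x y ↔ y ^ 2 = (x - e) * (x - f) * (x - h) := by
  rw [Affine.equation_iff, splitCurve]
  constructor <;> intro hxy <;> linear_combination hxy

theorem splitCurve_rotate (e f h : F) : splitCurve e f h = splitCurve f h e := by
  simp only [splitCurve]
  ring_nf

theorem splitCurve_isElliptic (h2 : (2 : F) ≠ 0) (hef : e ≠ f) (heh : e ≠ h) (hfh : f ≠ h) :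
    (splitCurve e f h).IsElliptic := by
  rw [isElliptic_iff]
  have hΔ : (splitCurve e f h).Δ = (2 ^ 2 * (e - f) * (e - h) * (f - h)) ^ 2 := by
    simp only [splitCurve, WeierstrassCurve.Δ, WeierstrassCurve.b₂, WeierstrassCurve.b₄,
      WeierstrassCurve.b₆, WeierstrassCurve.b₈]
    ring
  rw [hΔ, isUnit_iff_ne_zero]
  exact pow_ne_zero 2 (mul_ne_zero (mul_ne_zero (mul_ne_zero (pow_ne_zero 2 h2)
    (sub_ne_zero.2 hef)) (sub_ne_zero.2 heh)) (sub_ne_zero.2 hfh))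

variable [DecidableEq F]

-- `(x + ab + ac + bc, (a + b)(a + c)(b + c))` is a half of `(x, abc)`.
theorem some_mem_range_two_nsmul_of_sub_eq_sq {a b c x : F} (h2 : (2 : F) ≠ 0) (hab : a + b ≠ 0)
    (hac : a + c ≠ 0) (hbc : b + c ≠ 0) (he : x - e = a ^ 2) (hf : x - f = b ^ 2)
    (hh : x - h = c ^ 2) (hP : (splitCurve e f h).Nonsingular x (a * b * c)) :
    .some _ _ hP ∈ (nsmulAddMonoidHom (α := (splitCurve e f h).Point) 2).range := by
  obtain rfl : e = x - a ^ 2 := by rw [← he, sub_sub_cancel]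
  obtain rfl : f = x - b ^ 2 := by rw [← hf, sub_sub_cancel]
  obtain rfl : h = x - c ^ 2 := by rw [← hh, sub_sub_cancel]
  set X := x + a * b + a * c + b * c
  set Y := (a + b) * (a + c) * (b + c)
  have hYY : Y - (splitCurve (x - a ^ 2) (x - b ^ 2) (x - c ^ 2)).negY X Y = 2 * Y := by
    simp only [Affine.negY, splitCurve]
    ring
  have hne : Y - (splitCurve (x - a ^ 2) (x - b ^ 2) (x - c ^ 2)).negY X Y ≠ 0 := by
    rw [hYY]
    exact mul_ne_zero h2 (mul_ne_zero (mul_ne_zero hab hac) hbc)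
  have hYn := sub_ne_zero.1 hne
  have hXY : (splitCurve (x - a ^ 2) (x - b ^ 2) (x - c ^ 2)).Nonsingular X Y := by
    refine (Affine.nonsingular_iff ..).2 ⟨?_, .inr hYn⟩
    rw [splitCurve_equation_iff]
    ring
  have hslope : (splitCurve (x - a ^ 2) (x - b ^ 2) (x - c ^ 2)).slope X X Y Y = a + b + c := by
    rw [Affine.slope_of_Y_ne rfl hYn, div_eq_iff hne, hYY]
    simp only [splitCurve]
    ring
  refine ⟨.some X Y hXY, ?_⟩
  rw [nsmulAddMonoidHom_apply, two_nsmul, Affine.Point.add_self_of_Y_ne hYn,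
    Affine.Point.some.injEq, Affine.addY, Affine.negAddY, hslope]
  simp only [Affine.negY, Affine.addX, splitCurve]
  constructor <;> ring

theorem mem_range_two_nsmul_of_isSquare (h2 : (2 : F) ≠ 0) (hef : e ≠ f) (heh : e ≠ h)
    (hfh : f ≠ h) {x y : F} (hP : (splitCurve e f h).Nonsingular x y) (hxe : IsSquare (x - e))
    (hxf : IsSquare (x - f)) (hxh : IsSquare (x - h)) :
    .some x y hP ∈ (nsmulAddMonoidHom (α := (splitCurve e f h).Point) 2).range := by
  have hxy := splitCurve_equation_iff.1 hP.1
  obtain ⟨a, ha⟩ := isSquare_iff_exists_sq _ |>.1 hxe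
  obtain ⟨b, hb⟩ := isSquare_iff_exists_sq _ |>.1 hxf
  obtain ⟨c, hc, rfl⟩ : ∃ c, x - h = c ^ 2 ∧ y = a * b * c := by
    obtain ⟨c, hc⟩ := isSquare_iff_exists_sq _ |>.1 hxh
    have hsq : y ^ 2 = (a * b * c) ^ 2 := by rw [hxy, ha, hb, hc]; ring
    rcases sq_eq_sq_iff_eq_or_eq_neg.1 hsq with hy | hy
    · exact ⟨c, hc, hy⟩
    · exact ⟨-c, by rw [hc, neg_sq], by rw [hy, mul_neg]⟩
  exact some_mem_range_two_nsmul_of_sub_eq_sq h2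
    (fun h0 => hef (by linear_combination hb - ha + (b - a) * h0))
    (fun h0 => heh (by linear_combination hc - ha + (c - a) * h0))
    (fun h0 => hfh (by linear_combination hc - hb + (c - b) * h0)) ha hb hc hP

theorem isSquare_addX_sub {x₁ y₁ x₂ y₂ : F} (h₁ : (splitCurve e f h).Equation x₁ y₁)
    (h₂ : (splitCurve e f h).Equation x₂ y₂) (hx : x₁ ≠ x₂)
    (hsq : SameSquareClass (x₁ - e) (x₂ - e)) :
    IsSquare ((splitCurve e f h).addX x₁ x₂ ((splitCurve e f h).slope x₁ x₂ y₁ y₂) - e) := by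
  obtain ⟨s, hs, hse⟩ := hsq
  rw [splitCurve_equation_iff] at h₁ h₂
  have hd : x₁ - x₂ ≠ 0 := sub_ne_zero.2 hx
  refine ⟨(s ^ 2 * y₂ - y₁) / (s * (x₁ - x₂)), ?_⟩
  rw [Affine.slope_of_X_ne hx, Affine.addX]
  simp only [splitCurve]
  field_simp
  obtain rfl : x₁ = e + (x₂ - e) * s ^ 2 := by linear_combination hse
  linear_combination (s ^ 2 - 1) * h₁ - (s ^ 4 - s ^ 2) * h₂

/-- The affine points of `y² = (x - e)(x - f)(x - h)` at which `x - e`, `x - f` and `x - h` have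
the square classes of the three given elements. -/
def squareClass (e f h : F) (d : F × F × F) : Set (splitCurve e f h).Point :=
  {P | ∃ x y hxy, P = .some x y hxy ∧ SameSquareClass (x - e) d.1 ∧
    SameSquareClass (x - f) d.2.1 ∧ SameSquareClass (x - h) d.2.2}

theorem sub_mem_range_two_nsmul_of_mem_squareClass (h2 : (2 : F) ≠ 0) (hef : e ≠ f) (heh : e ≠ h)
    (hfh : f ≠ h) {d : F × F × F} {P Q : (splitCurve e f h).Point} (hP : P ∈ squareClass e f h d)
    (hQ : Q ∈ squareClass e f h d) :
    P - Q ∈ (nsmulAddMonoidHom (α := (splitCurve e f h).Point) 2).range := by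
  suffices hadd : P + Q ∈ (nsmulAddMonoidHom (α := (splitCurve e f h).Point) 2).range by
    rw [show P - Q = P + Q - 2 • Q by rw [two_nsmul]; abel]
    exact sub_mem hadd ⟨Q, rfl⟩
  obtain ⟨x₁, y₁, h₁, rfl, he₁, hf₁, hh₁⟩ := hP
  obtain ⟨x₂, y₂, h₂, rfl, he₂, hf₂, hh₂⟩ := hQ
  by_cases hx : x₁ = x₂
  · rcases Affine.Point.X_eq_iff.1 hx with hPQ | hPQ
    · exact ⟨.some x₂ y₂ h₂, by rw [nsmulAddMonoidHom_apply, two_nsmul, hPQ]⟩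
    · rw [hPQ, neg_add_cancel]
      exact zero_mem _
  · rw [Affine.Point.add_of_X_ne hx]
    have hrot := splitCurve_rotate e f h
    have hrot' := hrot.trans (splitCurve_rotate f h e)
    refine mem_range_two_nsmul_of_isSquare h2 hef heh hfh _
      (isSquare_addX_sub h₁.1 h₂.1 hx (he₁.trans he₂.symm)) ?_ ?_
    · rw [hrot]
      exact isSquare_addX_sub (hrot ▸ h₁.1) (hrot ▸ h₂.1) hx (hf₁.trans hf₂.symm)
    · rw [hrot']
      exact isSquare_addX_sub (hrot' ▸ h₁.1) (hrot' ▸ h₂.1) hx (hh₁.trans hh₂.symm)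

end SplitCurve

theorem splitCurve_finiteIndex_range_two_nsmul {e f h : ℤ} (hef : e ≠ f) (heh : e ≠ h)
    (hfh : f ≠ h) :
    (nsmulAddMonoidHom (α := (splitCurve (e : ℚ) f h).Point) 2).range.FiniteIndex := by
  have hfin (b : ℤ) : {d : ℤ | |d| ≤ b}.Finite :=
    (Set.finite_Icc (-b) b).subset fun _ hd => abs_le.1 hd
  refine finiteIndex_of_finite_cover
    ((hfin |(e - f) * (e - h)|).prod ((hfin |(f - e) * (f - h)|).prod (hfin |(h - e) * (h - f)|)))
    (C := fun d => squareClass (e : ℚ) f h (d.1, d.2.1, d.2.2))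
    (fun d _ P hP Q hQ => sub_mem_range_two_nsmul_of_mem_squareClass two_ne_zero
      (mod_cast hef) (mod_cast heh) (mod_cast hfh) hP hQ) fun P hP => ?_
  match P with
  | 0 => exact absurd (zero_mem _) hP
  | .some x y hxy =>
    have hxy' := splitCurve_equation_iff.1 hxy.1
    obtain ⟨d₁, hd₁, h₁⟩ := exists_intCast_sameSquareClass_sub hef heh hxy'
    obtain ⟨d₂, hd₂, h₂⟩ := exists_intCast_sameSquareClass_sub hef.symm hfh
      (hxy'.trans (by ring : _ = (x - f) * (x - e) * (x - h)))
    obtain ⟨d₃, hd₃, h₃⟩ := exists_intCast_sameSquareClass_sub heh.symm hfh.symm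
      (hxy'.trans (by ring : _ = (x - h) * (x - e) * (x - f)))
    exact ⟨(d₁, d₂, d₃), ⟨hd₁, hd₂, hd₃⟩, x, y, hxy, rfl, h₁, h₂, h₃⟩

theorem splitCurve_fg_point {e f h : ℤ} (hef : e ≠ f) (heh : e ≠ h) (hfh : f ≠ h) :
    AddGroup.FG (splitCurve (e : ℚ) f h).Point :=
  have := splitCurve_isElliptic (F := ℚ) (e := e) (f := f) (h := h) two_ne_zero
    (mod_cast hef) (mod_cast heh) (mod_cast hfh)
  fg_point_of_finiteIndex_range_two_nsmul (splitCurve_finiteIndex_range_two_nsmul hef heh hfh)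

/-! ### The torsion of `E_n` -/

theorem not_two_dvd_num_and_den_of_padicValRat_eq_zero {u : ℚ} (hu : u ≠ 0)
    (hv : padicValRat 2 u = 0) : ¬ (2 : ℤ) ∣ u.num ∧ ¬ 2 ∣ u.den := by
  have hnum : 2 ∣ u.num.natAbs ↔ padicValInt 2 u.num ≠ 0 :=
    dvd_iff_padicValNat_ne_zero (Int.natAbs_ne_zero.2 (Rat.num_ne_zero.2 hu))
  have hden : 2 ∣ u.den ↔ padicValNat 2 u.den ≠ 0 := dvd_iff_padicValNat_ne_zero u.den_nz
  have hiff : 2 ∣ u.num.natAbs ↔ 2 ∣ u.den := by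
    rw [padicValRat_def, sub_eq_zero, Nat.cast_inj] at hv
    rw [hnum, hden, hv]
  have hden' : ¬ 2 ∣ u.den := fun h =>
    Nat.not_coprime_of_dvd_of_dvd one_lt_two (hiff.2 h) h u.reduced
  exact ⟨fun h => hden' (hiff.1 (Int.natCast_dvd.1 h)), hden'⟩

theorem one_le_padicValRat_two_sub_one {u : ℚ} (hu0 : u ≠ 0) (hu1 : u ≠ 1)
    (hv : padicValRat 2 u = 0) : 1 ≤ padicValRat 2 (u - 1) := by
  obtain ⟨hnum, hden⟩ := not_two_dvd_num_and_den_of_padicValRat_eq_zero hu0 hv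
  have hd0 : (u.den : ℚ) ≠ 0 := by exact_mod_cast u.den_nz
  have hsub : u - 1 = ((u.num - u.den : ℤ) : ℚ) / (u.den : ℚ) := by
    rw [eq_div_iff hd0, sub_mul, Rat.mul_den_eq_num]
    push_cast
    ring
  have hne : u.num - (u.den : ℤ) ≠ 0 := fun h => hu1 (sub_eq_zero.1 (by rw [hsub, h]; simp))
  have heven : 1 ≤ padicValInt 2 (u.num - u.den) :=
    ((padicValInt_dvd_iff 1 _).1 (by rw [pow_one]; push_cast; omega)).resolve_left hne
  rw [hsub, padicValRat.div (Int.cast_ne_zero.2 hne) hd0, padicValRat.of_int, padicValRat.of_nat,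
    padicValNat.eq_zero_of_not_dvd hden]
  omega

theorem two_le_padicValRat_two_sq_sub_one {u : ℚ} (hu0 : u ≠ 0) (hu1 : u ^ 2 - 1 ≠ 0)
    (hv : padicValRat 2 u = 0) : 2 ≤ padicValRat 2 (u ^ 2 - 1) := by
  have hfac : u ^ 2 - 1 = (u - 1) * -(-u - 1) := by ring
  rw [hfac, mul_ne_zero_iff, neg_ne_zero] at hu1
  have hsub := one_le_padicValRat_two_sub_one hu0 (sub_ne_zero.1 hu1.1) hv
  have hadd := one_le_padicValRat_two_sub_one (neg_ne_zero.2 hu0) (sub_ne_zero.1 hu1.2)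
    (by rw [padicValRat.neg, hv])
  rw [hfac, padicValRat.mul hu1.1 (neg_ne_zero.2 hu1.2), padicValRat.neg]
  omega

theorem padicValRat_two_sq_add_one {u : ℚ} (hu0 : u ≠ 0) (hu1 : u ^ 2 - 1 ≠ 0)
    (hv : padicValRat 2 u = 0) : padicValRat 2 (u ^ 2 + 1) = 1 := by
  have h2 : padicValRat 2 (2 : ℚ) = 1 := padicValRat.self one_lt_two
  have hsub := two_le_padicValRat_two_sq_sub_one hu0 hu1 hv
  have hadd : u ^ 2 + 1 = 2 + (u ^ 2 - 1) := by ring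
  rw [hadd, padicValRat.add_eq_of_lt (hadd ▸ by positivity) two_ne_zero hu1 (by omega), h2]

-- If `u = x(P) / n` for a point `P` of `E_n`, the argument on the left is `x(2P) / n`.
theorem padicValRat_two_doubling_lt {u : ℚ} (hu0 : u ≠ 0) (hu1 : u ^ 2 - 1 ≠ 0) :
    padicValRat 2 ((u ^ 2 + 1) ^ 2 / (4 * (u * (u ^ 2 - 1)))) < min 0 (padicValRat 2 u) := by
  have hp : u ^ 2 + 1 ≠ 0 := by positivity
  have h4 : padicValRat 2 (4 : ℚ) = 2 := by
    rw [show (4 : ℚ) = ((2 : ℕ) : ℚ) ^ 2 by norm_num, padicValRat.pow,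
      padicValRat.self one_lt_two]
    rfl
  have hval : padicValRat 2 ((u ^ 2 + 1) ^ 2 / (4 * (u * (u ^ 2 - 1)))) =
      2 * padicValRat 2 (u ^ 2 + 1) - (2 + (padicValRat 2 u + padicValRat 2 (u ^ 2 - 1))) := by
    rw [padicValRat.div (pow_ne_zero 2 hp) (by positivity), padicValRat.pow,
      padicValRat.mul four_ne_zero (mul_ne_zero hu0 hu1), padicValRat.mul hu0 hu1, h4]
    rfl
  rw [hval]
  by_cases hv : padicValRat 2 u = 0
  · have hsub := two_le_padicValRat_two_sq_sub_one hu0 hu1 hv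
    have hadd := padicValRat_two_sq_add_one hu0 hu1 hv
    omega
  · have hsq : padicValRat 2 (u ^ 2) = 2 * padicValRat 2 u := by rw [padicValRat.pow]; rfl
    have hone : padicValRat 2 (-1 : ℚ) = 0 := by rw [padicValRat.neg, padicValRat.one]
    have hadd : padicValRat 2 (u ^ 2 + 1) = min (2 * padicValRat 2 u) 0 := by
      rw [padicValRat.add_eq_min hp (pow_ne_zero 2 hu0) one_ne_zero
        (by rw [hsq, padicValRat.one]; omega), hsq, padicValRat.one]
    have hsub : padicValRat 2 (u ^ 2 - 1) = min (2 * padicValRat 2 u) 0 := by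
      rw [sub_eq_add_neg] at hu1 ⊢
      rw [padicValRat.add_eq_min hu1 (pow_ne_zero 2 hu0) (neg_ne_zero.2 one_ne_zero)
        (by rw [hsq, hone]; omega), hsq, hone]
    omega

theorem two_nsmul_some_eq_zero_iff {F : Type*} [Field F] [DecidableEq F] {W : Affine F} {x y : F}
    (h : W.Nonsingular x y) : 2 • Affine.Point.some x y h = 0 ↔ y = W.negY x y := by
  rw [two_nsmul, add_eq_zero_iff_eq_neg, Affine.Point.neg_some, Affine.Point.some.injEq]
  exact and_iff_right rfl

section CurveE

variable {n : ℕ}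

theorem curveE_two_nsmul_eq_zero_iff {x y : ℚ} (h : (curveE n).Nonsingular x y) :
    2 • Affine.Point.some x y h = 0 ↔ y = 0 := by
  rw [two_nsmul_some_eq_zero_iff]
  simp only [Affine.negY, curveE]
  constructor <;> intro hy <;> linarith

theorem curveE_two_nsmul {x y : ℚ} (h : (curveE n).Nonsingular x y) (hy : y ≠ 0) :
    ∃ (y' : ℚ) (h' : (curveE n).Nonsingular ((x ^ 2 + n ^ 2) ^ 2 / (4 * y ^ 2)) y'),
      2 • Affine.Point.some x y h = .some _ y' h' := by
  have hxy := (curveE_nonsingular_iff.1 h).1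
  have hyn : y ≠ (curveE n).negY x y := fun hyn =>
    hy ((curveE_two_nsmul_eq_zero_iff h).1 ((two_nsmul_some_eq_zero_iff h).2 hyn))
  have hslope : (curveE n).slope x x y y = (3 * x ^ 2 - n ^ 2) / (2 * y) := by
    rw [Affine.slope_of_Y_ne rfl hyn]
    simp only [Affine.negY, curveE]
    congr 1 <;> ring
  have hX : (curveE n).addX x x ((curveE n).slope x x y y) =
      (x ^ 2 + n ^ 2) ^ 2 / (4 * y ^ 2) := by
    rw [hslope]
    simp only [Affine.addX, curveE]
    field_simp
    grind
  refine ⟨_, hX ▸ Affine.nonsingular_add h h (fun h => hyn h.2), ?_⟩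
  rw [two_nsmul, Affine.Point.add_self_of_Y_ne hyn, Affine.Point.some.injEq]
  exact ⟨hX, rfl⟩

theorem curveE_nonsingular_zero_iff (hn : n ≠ 0) {x : ℚ} :
    (curveE n).Nonsingular x 0 ↔ x = 0 ∨ x = n ∨ x = -n := by
  rw [curveE_nonsingular_iff]
  constructor
  · rintro ⟨h, -⟩
    have hprod : x * ((x - n) * (x + n)) = 0 := by linear_combination -h
    rwa [mul_eq_zero, mul_eq_zero, sub_eq_zero, add_eq_zero_iff_eq_neg] at hprod
  · have hpos : 0 < (n : ℚ) ^ 2 := sq_pos_of_ne_zero (Nat.cast_ne_zero.2 hn)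
    rintro (rfl | rfl | rfl) <;> exact ⟨by ring, .inl fun h => by linarith⟩

theorem curveE_padicValRat_two_nsmul_lt (hn : n ≠ 0) {x y : ℚ} (h : (curveE n).Nonsingular x y)
    (hy : y ≠ 0) : padicValRat 2 ((x ^ 2 + n ^ 2) ^ 2 / (4 * y ^ 2) / n) <
      min 0 (padicValRat 2 (x / n)) := by
  have hn' : (n : ℚ) ≠ 0 := Nat.cast_ne_zero.2 hn
  have hxy : y ^ 2 = n ^ 3 * (x / n * ((x / n) ^ 2 - 1)) := by
    rw [(curveE_nonsingular_iff.1 h).1]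
    field_simp
  have hne : x / n * ((x / n) ^ 2 - 1) ≠ 0 := fun h0 =>
    hy (pow_eq_zero_iff two_ne_zero |>.1 (by rw [hxy, h0, mul_zero]))
  obtain ⟨hu0, hu1⟩ := mul_ne_zero_iff.1 hne
  convert padicValRat_two_doubling_lt hu0 hu1 using 2
  rw [hxy, show x ^ 2 + n ^ 2 = n ^ 2 * ((x / n) ^ 2 + 1) by field_simp]
  generalize x / n = u at *
  field_simp

theorem curveE_not_isOfFinAddOrder (hn : n ≠ 0) {x y : ℚ} (h : (curveE n).Nonsingular x y)
    (hy : y ≠ 0) : ¬ IsOfFinAddOrder (Affine.Point.some x y h) := by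
  have hn' : (n : ℚ) ≠ 0 := Nat.cast_ne_zero.2 hn
  refine not_isOfFinAddOrder_of_nsmul_lt (m := 2)
    (S := {P | ∃ x y h, y ≠ 0 ∧ P = Affine.Point.some x y h})
    (v := fun P => padicValRat 2 (P.xRep 0 / n)) ?_ ⟨x, y, h, hy, rfl⟩
  rintro _ ⟨x, y, h, hy, rfl⟩
  obtain ⟨y', h', hP⟩ := curveE_two_nsmul h hy
  have hlt := lt_min_iff.1 (curveE_padicValRat_two_nsmul_lt hn h hy)
  rw [hP]
  refine ⟨⟨_, y', h', ?_, rfl⟩, hlt.2⟩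
  rintro rfl
  refine hlt.1.ne ?_
  rcases (curveE_nonsingular_zero_iff hn).1 h' with hx | hx | hx
  · rw [hx, zero_div, padicValRat.zero]
  · rw [hx, div_self hn', padicValRat.one]
  · rw [hx, neg_div, div_self hn', padicValRat.neg, padicValRat.one]

theorem mem_twoTorsionE {P : (curveE n).Point} : P ∈ twoTorsionE n ↔ 2 • P = 0 :=
  AddSubgroup.torsionBy.nsmul_iff

theorem torsionE_eq_twoTorsionE (hn : n ≠ 0) : torsionE n = twoTorsionE n := by
  refine le_antisymm (fun P hP => ?_) (twoTorsionE_le n)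
  rw [mem_twoTorsionE]
  match P with
  | 0 => exact smul_zero (A := (curveE n).Point) 2
  | .some x y h =>
    rw [curveE_two_nsmul_eq_zero_iff]
    by_contra hy
    exact curveE_not_isOfFinAddOrder hn h hy hP

theorem two_nsmul_eq_zero_of_mem_torsionE (hn : n ≠ 0) {P : (curveE n).Point}
    (hP : P ∈ torsionE n) : 2 • P = 0 :=
  mem_twoTorsionE.1 (torsionE_eq_twoTorsionE hn ▸ hP)

theorem mem_twoTorsionE_iff (hn : n ≠ 0) (P : (curveE n).Point) :
    P ∈ twoTorsionE n ↔ P = 0 ∨ ∃ (x : ℚ) (h : (curveE n).Nonsingular x 0),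
      (x = 0 ∨ x = n ∨ x = -n) ∧ P = .some x 0 h := by
  rw [mem_twoTorsionE]
  match P with
  | 0 => exact iff_of_true (smul_zero (A := (curveE n).Point) 2) (.inl rfl)
  | .some x y h =>
    rw [curveE_two_nsmul_eq_zero_iff]
    constructor
    · rintro rfl
      exact .inr ⟨x, h, (curveE_nonsingular_zero_iff hn).1 h, rfl⟩
    · rintro (h0 | ⟨x', h', -, hP⟩)
      · exact absurd h0 (Affine.Point.some_ne_zero h)
      · exact (Affine.Point.some.inj hP).2

theorem card_torsionE (hn : n ≠ 0) : Nat.card (torsionE n) = 4 := by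
  have h₀ := (curveE_nonsingular_zero_iff hn (x := 0)).2 (.inl rfl)
  have h₁ := (curveE_nonsingular_zero_iff hn (x := n)).2 (.inr (.inl rfl))
  have h₂ := (curveE_nonsingular_zero_iff hn (x := -n)).2 (.inr (.inr rfl))
  have hset : (twoTorsionE n : Set (curveE n).Point) =
      {0, .some 0 0 h₀, .some (n : ℚ) 0 h₁, .some (-n : ℚ) 0 h₂} := by
    ext P
    rw [SetLike.mem_coe, mem_twoTorsionE_iff hn]
    simp only [Set.mem_insert_iff, Set.mem_singleton_iff]
    constructor
    · rintro (rfl | ⟨x, h, rfl | rfl | rfl, rfl⟩) <;> simp only [true_or, or_true]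
    · rintro (rfl | rfl | rfl | rfl)
      · exact .inl rfl
      · exact .inr ⟨_, h₀, .inl rfl, rfl⟩
      · exact .inr ⟨_, h₁, .inr (.inl rfl), rfl⟩
      · exact .inr ⟨_, h₂, .inr (.inr rfl), rfl⟩
  have hn' : (n : ℚ) ≠ 0 := Nat.cast_ne_zero.2 hn
  have hnn : (n : ℚ) ≠ -n := self_ne_neg.2 hn'
  rw [torsionE_eq_twoTorsionE hn]
  change Nat.card (twoTorsionE n : Set (curveE n).Point) = 4
  rw [hset, Nat.card_coe_set_eq, Set.ncard_insert_of_notMem, Set.ncard_insert_of_notMem,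
    Set.ncard_pair]
  · simpa using hnn
  · simp [hn'.symm, hn]
  · simp [(Affine.Point.some_ne_zero _).symm]

theorem curveE_eq_splitCurve (n : ℕ) : curveE n = splitCurve ((0 : ℤ) : ℚ) (n : ℤ) (-n : ℤ) := by
  simp only [curveE, splitCurve]
  push_cast
  ring_nf

theorem curveE_finiteIndex_range_two_nsmul (hn : n ≠ 0) :
    (nsmulAddMonoidHom (α := (curveE n).Point) 2).range.FiniteIndex := by
  rw [curveE_eq_splitCurve]
  exact splitCurve_finiteIndex_range_two_nsmul (by omega) (by omega) (by omega)

theorem curveE_fg_point (hn : n ≠ 0) : AddGroup.FG (curveE n).Point := by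
  rw [curveE_eq_splitCurve]
  exact splitCurve_fg_point (by omega) (by omega) (by omega)

end CurveE

/-! ### The dual isogeny and splittings of the torsion -/

section DualIsogeny

variable {n : ℕ}

theorem isSquare_of_sq_eq_sixteen_mul_cube {y : ℚ} (h : y ^ 2 = 16 * n ^ 3) : IsSquare n := by
  rcases eq_or_ne n 0 with rfl | hn
  · exact IsSquare.zero
  · have hn' : (n : ℚ) ≠ 0 := Nat.cast_ne_zero.2 hn
    refine Rat.isSquare_natCast_iff.1 ⟨y / (4 * n), ?_⟩
    field_simp
    linear_combination -h

theorem curveE₁_mul_sub_sq_ne_zero (hsq : ¬ IsSquare n) {x y : ℚ}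
    (h : (curveE₁ n).Nonsingular x y) (hx : x ≠ 0) : y * (4 * n ^ 2 - x ^ 2) ≠ 0 := by
  have hxy := (curveE₁_nonsingular_iff.1 h).1
  have hpos : 0 < x ^ 2 + 4 * (n : ℚ) ^ 2 := by positivity
  refine mul_ne_zero ?_ fun h0 => ?_
  · rintro rfl
    exact mul_ne_zero hx hpos.ne' (by linear_combination -hxy)
  · have hfac : (2 * n - x) * (2 * n + x) = 0 := by linear_combination h0
    rcases mul_eq_zero.1 hfac with hx' | hx'
    · obtain rfl : x = 2 * n := by linarith
      exact hsq (isSquare_of_sq_eq_sixteen_mul_cube (y := y) (by linear_combination hxy))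
    · obtain rfl : x = -(2 * n) := by linarith
      have hn : 0 < (n : ℚ) ^ 3 := by
        have : (n : ℚ) ≠ 0 := fun hn => hx (by rw [hn]; ring)
        positivity
      nlinarith [sq_nonneg y]

theorem phiHat_eq_zero_of_mem_twoTorsionE (hsq : ¬ IsSquare n) {P : (curveE₁ n).Point}
    (hP : phiHat n P ∈ twoTorsionE n) : phiHat n P = 0 := by
  match P with
  | 0 => exact map_zero (phiHat n)
  | .some x y h =>
    change phiHatFun n (.some x y h) ∈ twoTorsionE n at hP
    change phiHatFun n (.some x y h) = 0
    rcases eq_or_ne x 0 with rfl | hx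
    · exact phiHatFun_some_zero h
    · rw [phiHatFun_some h hx, mem_twoTorsionE, curveE_two_nsmul_eq_zero_iff] at hP
      exact absurd hP (div_ne_zero (curveE₁_mul_sub_sq_ne_zero hsq h hx) (by positivity))

theorem ne_zero_of_not_isSquare (hsq : ¬ IsSquare n) : n ≠ 0 := by
  rintro rfl
  exact hsq IsSquare.zero

theorem disjoint_torsionE_range_phiHat (hsq : ¬ IsSquare n) :
    Disjoint (torsionE n) (phiHat n).range := by
  rw [torsionE_eq_twoTorsionE (ne_zero_of_not_isSquare hsq), AddSubgroup.disjoint_def]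
  rintro _ hP ⟨Q, rfl⟩
  exact phiHat_eq_zero_of_mem_twoTorsionE hsq hP

theorem ker_phiHat (hsq : ¬ IsSquare n) : (phiHat n).ker = torsionE₁ n := by
  refine le_antisymm (fun P hP => ?_) fun P hP => ?_
  · refine isOfFinAddOrder_iff_nsmul_eq_zero.2 ⟨2, two_pos, ?_⟩
    rw [← phiFun_phiHatFun]
    exact congrArg (phiFun n) hP
  · exact AddSubgroup.disjoint_def.1 (disjoint_torsionE_range_phiHat hsq)
      ((phiHat n).isOfFinAddOrder hP) ⟨P, rfl⟩

theorem curveE_finite_addSubgroup (hn : n ≠ 0) (A : AddSubgroup (curveE n).Point) :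
    Module.Finite ℤ A := by
  have : Module.Finite ℤ (curveE n).Point := Module.Finite.iff_addGroup_fg.2 (curveE_fg_point hn)
  exact inferInstanceAs (Module.Finite ℤ (AddSubgroup.toIntSubmodule A))

theorem curveE_free_of_disjoint_torsionE (hn : n ≠ 0) {A : AddSubgroup (curveE n).Point}
    (hA : Disjoint (torsionE n) A) : Module.Free ℤ A := by
  have := curveE_finite_addSubgroup hn A
  have := isAddTorsionFree_of_disjoint_torsion hA
  infer_instance

theorem finiteIndex_range_phiHat (hn : n ≠ 0) : (phiHat n).range.FiniteIndex := by
  have := curveE_finiteIndex_range_two_nsmul hn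
  refine AddSubgroup.finiteIndex_of_le
    (H := (nsmulAddMonoidHom (α := (curveE n).Point) 2).range) ?_
  rintro _ ⟨P, rfl⟩
  exact two_nsmul_mem_range_phiHat n P

theorem finite_quotient_range_phiHat (hn : n ≠ 0) :
    Finite ((curveE n).Point ⧸ (phiHat n).range) := by
  have := finiteIndex_range_phiHat hn
  exact AddSubgroup.finite_quotient_of_finiteIndex

theorem finite_modN_curveE (hn : n ≠ 0) : Finite (ModN (curveE n).Point 2) := by
  refine Nat.finite_of_card_ne_zero ?_
  rw [natCard_modN]
  exact (curveE_finiteIndex_range_two_nsmul hn).index_ne_zero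

theorem nonempty_torsionSplitting (hsq : ¬ IsSquare n) : Nonempty (TorsionSplitting n) := by
  have hdisj := disjoint_torsionE_range_phiHat hsq
  have hfree := curveE_free_of_disjoint_torsionE (ne_zero_of_not_isSquare hsq) hdisj
  obtain ⟨A, hA, hle⟩ := exists_isCompl_ge_of_nsmul_mem (two_nsmul_mem_range_phiHat n) hdisj
  obtain ⟨A₁, hA₁⟩ := exists_isCompl_ker_of_free _ (phiHat n).rangeRestrict_surjective
  rw [AddMonoidHom.ker_rangeRestrict, ker_phiHat hsq] at hA₁
  exact ⟨⟨A, A₁, hA, hA₁, (AddSubgroup.map_le_range _ A₁).trans hle⟩⟩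

end DualIsogeny

namespace TorsionSplitting

variable {n : ℕ} (D : TorsionSplitting n)

theorem map_phiHat_A₁ (hsq : ¬ IsSquare n) : D.A₁.map (phiHat n) = (phiHat n).range := by
  rw [AddSubgroup.map_eq_range_iff, ker_phiHat hsq]
  exact D.isCompl₁.symm.codisjoint

theorem range_phiHat_le (hsq : ¬ IsSquare n) : (phiHat n).range ≤ D.A :=
  D.map_phiHat_A₁ hsq ▸ D.map_le

theorem finrank_range_phiHat (hsq : ¬ IsSquare n) :
    Module.finrank ℤ (phiHat n).range = Module.finrank ℤ D.A := by
  have hn := ne_zero_of_not_isSquare hsq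
  have := isAddTorsionFree_of_disjoint_torsion D.isCompl.disjoint
  have := curveE_finite_addSubgroup hn D.A
  have := finiteIndex_range_phiHat hn
  have := AddSubgroup.isFiniteRelIndex_of_finiteIndex (H := (phiHat n).range) (K := D.A)
  exact AddSubgroup.finrank_eq_of_isFiniteRelIndex (D.range_phiHat_le hsq)

theorem free_finite_finrank_A₁ (hsq : ¬ IsSquare n) :
    Module.Free ℤ D.A₁ ∧ Module.Finite ℤ D.A₁ ∧
      Module.finrank ℤ D.A₁ = Module.finrank ℤ D.A := by
  have hn := ne_zero_of_not_isSquare hsq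
  have := curveE_free_of_disjoint_torsionE hn (disjoint_torsionE_range_phiHat hsq)
  have := curveE_finite_addSubgroup hn (phiHat n).range
  obtain ⟨e⟩ := nonempty_addEquiv_range_of_isCompl_ker ((ker_phiHat hsq).symm ▸ D.isCompl₁)
  let eℤ : D.A₁ ≃ₗ[ℤ] (phiHat n).range := e.toIntLinearEquiv
  exact ⟨.of_equiv eℤ.symm, .equiv eℤ.symm, eℤ.finrank_eq.trans (D.finrank_range_phiHat hsq)⟩

theorem finrank_quotient_range_phiHat (hsq : ¬ IsSquare n) :
    Module.finrank (ZMod 2) ((curveE n).Point ⧸ (phiHat n).range) =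
      Module.finrank (ZMod 2) (D.A ⧸ D.image) + 2 := by
  have hn := ne_zero_of_not_isSquare hsq
  have hindex : (phiHat n).range.index = D.image.index * 4 := by
    rw [index_eq_relIndex_mul_natCard_of_isCompl D.isCompl (D.range_phiHat_le hsq),
      card_torsionE hn, ← D.map_phiHat_A₁ hsq]
    rfl
  have := finite_quotient_range_phiHat hn
  exact finrank_eq_add_of_natCard_eq_mul_pow hindex

theorem finrank_modN_curveE (hn : n ≠ 0) :
    Module.finrank (ZMod 2) (ModN (curveE n).Point 2) =
      Module.finrank (ZMod 2) (ModN D.A 2) + 2 := by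
  have hcard : Nat.card (ModN (curveE n).Point 2) = Nat.card (ModN D.A 2) * 4 := by
    rw [natCard_modN_of_isCompl D.isCompl fun _ => two_nsmul_eq_zero_of_mem_torsionE hn,
      card_torsionE hn]
  have := finite_modN_curveE hn
  exact finrank_eq_add_of_natCard_eq_mul_pow hcard

end TorsionSplitting

section TwoTorsion

variable {n : ℕ}

theorem bijective_twoTorsionInclusion (hn : n ≠ 0) :
    Function.Bijective (twoTorsionInclusion n) :=
  ⟨AddSubgroup.inclusion_injective (twoTorsionE_le n),
    fun t => ⟨⟨t, torsionE_eq_twoTorsionE hn ▸ t.2⟩, rfl⟩⟩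

theorem bijective_twoTorsionE_to_modN (hn : n ≠ 0) :
    Function.Bijective ((ModN.mkQ 2).comp (twoTorsionInclusion n)) := by
  rw [AddMonoidHom.coe_comp]
  refine Function.Bijective.comp ⟨?_, Submodule.Quotient.mk_surjective _⟩
    (bijective_twoTorsionInclusion hn)
  refine (injective_iff_map_eq_zero (ModN.mkQ 2)).2 fun a ha => ?_
  obtain ⟨t, rfl⟩ := (Submodule.Quotient.mk_eq_zero _).1 ha
  rw [LinearMap.lsmul_apply, natCast_zsmul]
  exact Subtype.ext (two_nsmul_eq_zero_of_mem_torsionE hn t.2)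

theorem torsionImage_eq_bot (hsq : ¬ IsSquare n) : torsionImage n = ⊥ := by
  rw [torsionImage, (AddSubgroup.map_eq_bot_iff _).2 (ker_phiHat hsq).ge,
    AddSubgroup.bot_addSubgroupOf]

theorem bijective_twoTorsionE_to_quotient_torsionImage (hsq : ¬ IsSquare n) :
    Function.Bijective ((QuotientAddGroup.mk' (torsionImage n)).comp (twoTorsionInclusion n)) := by
  rw [AddMonoidHom.coe_comp]
  refine Function.Bijective.comp ⟨?_, QuotientAddGroup.mk'_surjective _⟩
    (bijective_twoTorsionInclusion (ne_zero_of_not_isSquare hsq))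
  rw [← AddMonoidHom.ker_eq_bot_iff, QuotientAddGroup.ker_mk', torsionImage_eq_bot hsq]

end TwoTorsion

theorem proposition6p3 (n : ℕ) (hn : 1 < n) (hsq : ¬ IsSquare n) :
    -- subgroups `A`, `A₁` as required exist
    Nonempty (TorsionSplitting n) ∧
    -- for every choice of them, they are free of one and the same finite rank `r`, and the
    -- dimension formulas hold
    (∀ D : TorsionSplitting n, ∃ r : ℕ,
      (Module.Free ℤ D.A ∧ Module.Finite ℤ D.A ∧ Module.finrank ℤ D.A = r) ∧
      (Module.Free ℤ D.A₁ ∧ Module.Finite ℤ D.A₁ ∧ Module.finrank ℤ D.A₁ = r) ∧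
      Module.Finite (ZMod 2) ((curveE n).Point ⧸ (phiHat n).range) ∧
      Module.Finite (ZMod 2) (ModN (curveE n).Point 2) ∧
      (Module.finrank (ZMod 2) (D.A ⧸ D.image) : ℤ) =
        Module.finrank (ZMod 2) ((curveE n).Point ⧸ (phiHat n).range) - 2 ∧
      r = Module.finrank (ZMod 2) (ModN D.A 2) ∧
      (Module.finrank (ZMod 2) (ModN D.A 2) : ℤ) =
        Module.finrank (ZMod 2) (ModN (curveE n).Point 2) - 2) ∧
    -- `E_n(ℚ)[2]` consists of the four points `∞, (0,0), (n,0), (-n,0)`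
    (Nat.card (twoTorsionE n) = 4 ∧
      ∀ P : (curveE n).Point, P ∈ twoTorsionE n ↔ P = 0 ∨
        ∃ (x : ℚ) (h : (curveE n).Nonsingular x 0),
          (x = 0 ∨ x = n ∨ x = -n) ∧ P = WeierstrassCurve.Affine.Point.some x 0 h) ∧
    -- and it maps bijectively onto `T/2T` and onto `T/φ̂₁(T₁)`
    Function.Bijective ((ModN.mkQ 2).comp (twoTorsionInclusion n)) ∧
    Function.Bijective ((QuotientAddGroup.mk' (torsionImage n)).comp (twoTorsionInclusion n)) := by
  have hn0 := ne_zero_of_not_isSquare hsq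
  refine ⟨nonempty_torsionSplitting hsq, fun D => ?_,
    ⟨torsionE_eq_twoTorsionE hn0 ▸ card_torsionE hn0, mem_twoTorsionE_iff hn0⟩,
    bijective_twoTorsionE_to_modN hn0, bijective_twoTorsionE_to_quotient_torsionImage hsq⟩
  have hfree : Module.Free ℤ D.A := curveE_free_of_disjoint_torsionE hn0 D.isCompl.disjoint
  have hfinite : Module.Finite ℤ D.A := curveE_finite_addSubgroup hn0 D.A
  have := finite_quotient_range_phiHat hn0
  have := finite_modN_curveE hn0
  refine ⟨Module.finrank ℤ D.A, ⟨hfree, hfinite, rfl⟩, D.free_finite_finrank_A₁ hsq,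
    .of_finite, .of_finite, ?_, (finrank_modN_eq_finrank 2).symm, ?_⟩
  · exact eq_sub_of_add_eq (mod_cast (D.finrank_quotient_range_phiHat hsq).symm)
  · exact eq_sub_of_add_eq (mod_cast (D.finrank_modN_curveE hn0).symm)
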